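/- Let $K$ be a compact convex subset of a Hausdorff locally convex real topological vector space, let $\partial_eK$ be its set of extreme points, and let $A_c(K)$ be the set of continuous affine functions $K\to(0,\infty)$. For $f,g\in A_c(K)$ put $m(f,g)=\sup\{\lambda>0:\lambda g\le f\}$. A bijection $\Phi:A_c(K)\to A_c(K)$ is gauge-preserving if $m(\Phi(f),\Phi(g))=m(f,g)$ for all $f,g$, and gauge-reversing if $m(\Phi(f),\Phi(g))=m(g,f)$ for all $f,g$. Let $\Phi$ be a bijection of $A_c(K)$ with $\Phi(\mathbb 1_K)=\mathbb 1_K$. (1) Suppose $\Phi$ is gauge-reversing. Let $A_{usc}(K)$ be the cone of upper semicontinuous affine functions $K\to[0,\infty)$; a vector $p\in A_{usc}(K)$ is extremal if $\{f\in A_{usc}(K): f\le p\}=\{tp:0\le t\le1\}$, and normalized if $\inf\{\mu>0:p\le\mu\mathbb 1_K\}=1$. For $\psi\in\partial_eK$ let $I^\infty_{\{\psi\}}$ be the function on $K$ with value $1$ at $\psi$ and $\infty$ elsewhere, and let $\Phi_{lsc}(I^\infty_{\{\psi\}})=\inf\{\Phi(f): f\in A_c(K),\ f\le I^\infty_{\{\psi\}}\}$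 (pointwise infimum). Then there is exactly one bijection $\alpha:\partial_eK\to\partial_eK$ such that for every $\psi\in\partial_eK$ the function $\Phi_{lsc}(I^\infty_{\{\psi\}})$ is a normalized extremal vector of $A_{usc}(K)$ with value $1$ at $\alpha(\psi)$ (the bijection induced by $\Phi$). Any bijection $\alpha'$ of $\partial_eK$ with $\Phi(f)|_{\partial_eK}=\frac1f\circ\alpha'^{-1}$ and $\Phi^{-1}(g)|_{\partial_eK}=\frac1g\circ\alpha'$ for all $f,g\in A_c(K)$ equals $\alpha$. Moreover $\Phi$ is an involution ($\Phi\circ\Phi=\mathrm{id}$) if and only if $\alpha$ is an involution ($\alpha\circ\alpha=\mathrm{id}$). (2) Suppose $\Phi$ is gauge-preserving. Then there is exactly one bijection $\alpha:\partial_eK\to\partial_eK$ with $\Phi(f)|_{\partial_eK}=f\circ\alpha^{-1}$ and $\Phi^{-1}(g)|_{\partial_eK}=g\circ\alpha$ for all $f,g\in A_c(K)$ (the bijection induced by $\Phi$), and $\Phi$ is an involution if and only if $\alpha$ is an involution. -/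

import Mathlib

namespace CompactConvex

variable {E : Type*} [AddCommGroup E] [Module ℝ E] [TopologicalSpace E]

/-- `f` is affine on the convex set `K`. -/
def IsAffineFun {K : Set E} (f : K → ℝ) : Prop :=
  ∀ x y z : K, ∀ a b : ℝ, 0 ≤ a → 0 ≤ b → a + b = 1 →
    (z : E) = a • (x : E) + b • (y : E) → f z = a * f x + b * f y

/-- `A_c(K)`: the continuous affine functions on `K` with values in `(0, ∞)`. -/
def Ac (K : Set E) : Set (K → ℝ) :=
  {f | Continuous f ∧ IsAffineFun f ∧ ∀ x, 0 < f x}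

/-- The order unit: the constant function `1`. -/
def unit (K : Set E) : Ac K :=
  ⟨fun _ => 1, continuous_const, fun _ _ _ a b _ _ hab _ => by simp [hab], fun _ => one_pos⟩

/-- `m(f, g) = sup {r > 0 : r g ≤ f}`. -/
noncomputable def gaugeInf {K : Set E} (f g : K → ℝ) : ℝ :=
  sSup {r : ℝ | 0 < r ∧ ∀ x, r * g x ≤ f x}

/-- `M(f, g) = inf {r > 0 : f ≤ r g}`. -/
noncomputable def gaugeSup {K : Set E} (f g : K → ℝ) : ℝ :=
  sInf {r : ℝ | 0 < r ∧ ∀ x, f x ≤ r * g x}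

def IsGaugePreserving {K : Set E} (Φ : Ac K ≃ Ac K) : Prop :=
  ∀ f g : Ac K, gaugeInf (Φ f : K → ℝ) (Φ g) = gaugeInf (f : K → ℝ) g

def IsGaugeReversing {K : Set E} (Φ : Ac K ≃ Ac K) : Prop :=
  ∀ f g : Ac K, gaugeInf (Φ f : K → ℝ) (Φ g) = gaugeInf (g : K → ℝ) f

/-- `∂ₑK`, regarded as a subset of the type of points of `K`. -/
def extBd (K : Set E) : Set K := {x | (x : E) ∈ K.extremePoints ℝ}

/-- `A_usc(K)`: the upper semicontinuous affine functions on `K` with values in `[0, ∞)`. -/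
def Ausc (K : Set E) : Set (K → ℝ) :=
  {p | UpperSemicontinuous p ∧ IsAffineFun p ∧ ∀ x, 0 ≤ p x}

/-- Extremal vectors of the cone `A_usc(K)`. -/
def IsExtremalVector {K : Set E} (p : K → ℝ) : Prop :=
  p ∈ Ausc K ∧ {f | f ∈ Ausc K ∧ f ≤ p} = {f | ∃ t ∈ Set.Icc (0 : ℝ) 1, f = t • p}

/-- Extremal vectors `p` of `A_usc(K)` normalized by `M(p, 1) = 1`. -/
def IsNormalizedExtremal {K : Set E} (p : K → ℝ) : Prop :=
  IsExtremalVector p ∧ gaugeSup p (unit K : K → ℝ) = 1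

open Classical in
/-- The function with value `1` at `ψ` and `∞` elsewhere; it is affine and lower semicontinuous
when `ψ` is an extreme point. -/
noncomputable def coIndicator {K : Set E} (ψ : K) : K → EReal :=
  fun x => if x = ψ then 1 else ⊤

/-- The extension of a gauge-reversing `Φ` to lower semicontinuous affine functions
`h : K → (0, ∞]`: the pointwise infimum of all `Φ f` with `f ∈ A_c(K)`, `f ≤ h`. -/
noncomputable def lscExtension {K : Set E} (Φ : Ac K ≃ Ac K) (h : K → EReal) : K → ℝ :=
  fun x => ⨅ f : {f : Ac K // ∀ y, ((f : K → ℝ) y : EReal) ≤ h y}, (Φ f.1 : K → ℝ) x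

/-- `α` is the bijection of `∂ₑK` induced by a gauge-reversing `Φ`: the extension of `Φ` sends
the co-extremal function at `ψ` to a normalized extremal vector of `A_usc(K)` whose maximal
value `1` is attained at `α ψ`. -/
def IsInducedByReversing {K : Set E} (Φ : Ac K ≃ Ac K) (α : extBd K ≃ extBd K) : Prop :=
  ∀ ψ : extBd K,
    IsNormalizedExtremal (lscExtension Φ (coIndicator (ψ : K))) ∧
      lscExtension Φ (coIndicator (ψ : K)) (α ψ : K) = 1

/-- `Φ f = (1 / f) ∘ α⁻¹` and `Φ⁻¹ g = (1 / g) ∘ α` on `∂ₑK`. -/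
def ReciprocalOnBoundary {K : Set E} (Φ : Ac K ≃ Ac K) (α : extBd K ≃ extBd K) : Prop :=
  (∀ (f : Ac K) (ψ : extBd K),
      (Φ f : K → ℝ) (ψ : K) = 1 / (f : K → ℝ) (α.symm ψ : K)) ∧
    ∀ (g : Ac K) (ψ : extBd K),
      (Φ.symm g : K → ℝ) (ψ : K) = 1 / (g : K → ℝ) (α ψ : K)

/-- `α` is the bijection of `∂ₑK` induced by a gauge-preserving `Φ`:
`Φ f = f ∘ α⁻¹` and `Φ⁻¹ g = g ∘ α` on `∂ₑK`. -/
def IsInducedByPreserving {K : Set E} (Φ : Ac K ≃ Ac K) (α : extBd K ≃ extBd K) : Prop :=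
  (∀ (f : Ac K) (ψ : extBd K), (Φ f : K → ℝ) (ψ : K) = (f : K → ℝ) (α.symm ψ : K)) ∧
    ∀ (g : Ac K) (ψ : extBd K), (Φ.symm g : K → ℝ) (ψ : K) = (g : K → ℝ) (α ψ : K)

end CompactConvex

namespace CompactConvex

open Set Filter Topology

/-! ### Affine functions and their graphs -/

/-! Since `m(f, g)` is an attained supremum, a gauge-reversing map is exactly one that reverses
order and is homogeneous of degree `-1`. For extreme `ψ` the sets `{f | f ψ < t}` are directed, and
a proper directed lower set containing one of them is, up to its boundary, another one
(`exists_bound_iff`). Transported by `Φ`, this rigidity makes `pureImage Φ ψ` an extremal vector;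
comparison with constants gives it maximum `1`, attained on `∂ₑK` by Bauer's principle.

The number `pureImage Φ ψ χ` is the infimum over `f` of `f ψ * Φ f χ`, hence symmetric under
exchanging `Φ` with its inverse and `ψ` with `χ` (`pureImage_symm`). It remains to see that the
relation `pureImage Φ ψ χ = 1` is the graph of a bijection. If `q` is extremal with `q χ = 1 = max
q`, the extension of `Φ` sends the segment from `1` in direction `-q` to a ray from `1` whose
direction is `pureImage Φ χ`, which depends on `χ` only (`isDualPair_segment_pureImage`). So `χ`
determines `q`, and hence `ψ` when `q = pureImage Φ ψ`; by symmetry `ψ` determines `χ`.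

A gauge-preserving map permutes the evaluations at extreme points, by the same rigidity
(`ScaleMonotone.exists_apply_eq`). For gauge-reversing `Φ` this applies to `Φ ∘ Φ` and gives a
boundary bijection `β`; `pureImage_comp_self` identifies `β` with `α ∘ α`. Continuous affine
functions are determined on `∂ₑK` and characterize its points, so `Φ ∘ Φ = id` exactly when `α ∘ α =
id`. -/

/-- The graph of a function on `K`, as a subset of `E × ℝ`. -/
def graphSet {E : Type*} {K : Set E} (f : K → ℝ) : Set (E × ℝ) := range fun x : K => ((x : E), f x)

theorem isCompact_graphSet {E : Type*} [TopologicalSpace E] {K : Set E} (hK : IsCompact K) {f : K → ℝ} (hf : Continuous f) :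
    IsCompact (graphSet f) := by
  have := isCompact_iff_compactSpace.1 hK
  exact isCompact_range (by fun_prop)

section Affine

variable {E : Type*} [AddCommGroup E] [Module ℝ E] {K : Set E}

theorem IsAffineFun.sub {f g : K → ℝ} (hf : IsAffineFun f) (hg : IsAffineFun g) :
    IsAffineFun (fun x => f x - g x) := by
  intro x y z a b ha hb hab hz
  simp only [hf x y z a b ha hb hab hz, hg x y z a b ha hb hab hz]
  ring

theorem IsAffineFun.neg {f : K → ℝ} (hf : IsAffineFun f) : IsAffineFun (fun x => -f x) := by
  intro x y z a b ha hb hab hz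
  simp only [hf x y z a b ha hb hab hz]
  ring

theorem IsAffineFun.mul_add {f : K → ℝ} (hf : IsAffineFun f) (c d : ℝ) :
    IsAffineFun (fun x => c * f x + d) := by
  intro x y z a b ha hb hab hz
  simp only [hf x y z a b ha hb hab hz]
  linear_combination -(d * hab)

theorem convex_graphSet (hconv : Convex ℝ K) {f : K → ℝ} (hf : IsAffineFun f) :
    Convex ℝ (graphSet f) := by
  rintro _ ⟨x, rfl⟩ _ ⟨y, rfl⟩ a b ha hb hab
  refine ⟨⟨a • (x : E) + b • (y : E), hconv x.2 y.2 ha hb hab⟩, ?_⟩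
  simp [hf x y ⟨a • (x : E) + b • (y : E), hconv x.2 y.2 ha hb hab⟩ a b ha hb hab rfl]

end Affine

variable {E : Type*} [AddCommGroup E] [Module ℝ E] [TopologicalSpace E] {K : Set E}

/-! ### Separation of convex sets by graphs of continuous affine functions -/

theorem isAffineFun_clm (φ : StrongDual ℝ E) (c d : ℝ) :
    IsAffineFun (fun x : K => c * φ (x : E) + d) := by
  intro x y z a b _ _ hab hz
  have hb : b = 1 - a := by linarith
  simp only [hz, map_add, map_smul, smul_eq_mul, hb]
  ring

section Separation

variable [IsTopologicalAddGroup E] [ContinuousSMul ℝ E]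

/-- The join is a continuous image of `s × t × [0, 1]`, so compactness needs no completeness of the
space. -/
theorem isCompact_convexJoin {F : Type*} [AddCommGroup F] [Module ℝ F] [TopologicalSpace F]
    [IsTopologicalAddGroup F] [ContinuousSMul ℝ F] {s t : Set F}
    (hs : IsCompact s) (ht : IsCompact t) : IsCompact (convexJoin ℝ s t) := by
  have h : convexJoin ℝ s t =
      (fun p : (F × F) × ℝ => (1 - p.2) • p.1.1 + p.2 • p.1.2) '' ((s ×ˢ t) ×ˢ Icc (0 : ℝ) 1) := by
    ext z
    simp only [mem_convexJoin, segment_eq_image, mem_image, mem_prod, Prod.exists]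
    constructor
    · rintro ⟨a, ha, b, hb, θ, hθ, rfl⟩
      exact ⟨a, b, θ, ⟨⟨ha, hb⟩, hθ⟩, rfl⟩
    · rintro ⟨a, b, θ, ⟨⟨ha, hb⟩, hθ⟩, rfl⟩
      exact ⟨a, ha, b, hb, θ, hθ, rfl⟩
  rw [h]
  exact ((hs.prod ht).prod isCompact_Icc).image (by fun_prop)

/-- A compact convex set lying below a closed convex upward closed set in `E × ℝ` is separated
from it by the graph of a continuous affine function. -/
theorem exists_affine_between [LocallyConvexSpace ℝ E] {A C : Set (E × ℝ)} (hA : Convex ℝ A)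
    (hAc : IsCompact A) (hC : Convex ℝ C) (hCc : IsClosed C)
    (hup : ∀ x t t', (x, t) ∈ C → t ≤ t' → (x, t') ∈ C) (hdisj : Disjoint A C)
    (hov : ∃ x s t, (x, s) ∈ A ∧ (x, t) ∈ C) :
    ∃ g : E → ℝ, Continuous g ∧ IsAffineFun (fun x : K => g x) ∧
      (∀ x s, (x, s) ∈ A → s < g x) ∧ ∀ x t, (x, t) ∈ C → g x < t := by
  obtain ⟨F, u, v, hFA, huv, hFC⟩ := geometric_hahn_banach_compact_closed hA hAc hC hCc hdisj
  set φ : StrongDual ℝ E := F.comp (ContinuousLinearMap.inl ℝ E ℝ) with hφ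
  set σ : ℝ := F (0, 1) with hσ
  have hF : ∀ x t, F (x, t) = φ x + σ * t := by
    intro x t
    have : ((x, t) : E × ℝ) = (x, 0) + t • (0, 1) := by simp
    rw [this, map_add, map_smul, hφ, hσ]
    simp [mul_comm]
  obtain ⟨x₀, s₀, t₀, h₀A, h₀C⟩ := hov
  -- Some vertical line meets both `A` and the upward closed `C`, so the functional increases
  -- vertically and its level set `F = u` is a graph.
  have hpos : 0 < σ := by
    by_contra hneg
    push Not at hneg
    have h1 := hFC _ (hup x₀ t₀ (max t₀ s₀) h₀C (le_max_left _ _))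
    have h2 := hFA _ h₀A
    rw [hF] at h1 h2
    have : σ * max t₀ s₀ ≤ σ * s₀ := mul_le_mul_of_nonpos_left (le_max_right _ _) hneg
    linarith
  refine ⟨fun x => (-σ⁻¹) * φ x + u * σ⁻¹, by fun_prop, isAffineFun_clm φ _ _, ?_, ?_⟩
  · intro x s hs
    have h := hFA _ hs
    rw [hF] at h
    have : s < (u - φ x) / σ := by rw [lt_div_iff₀ hpos]; linarith
    calc s < (u - φ x) / σ := this
      _ = _ := by ring
  · intro x t ht
    have h := hFC _ ht
    rw [hF] at h
    have : (u - φ x) / σ < t := by rw [div_lt_iff₀ hpos]; linarith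
    calc _ = (u - φ x) / σ := by ring
      _ < t := this

variable [LocallyConvexSpace ℝ E] [T2Space E]

/-- A compact convex set lying strictly below a lower semicontinuous affine function is separated
from it by a continuous affine function. -/
theorem exists_affine_below_lsc (hK : IsCompact K) (hconv : Convex ℝ K) {l : K → ℝ}
    (hl : LowerSemicontinuous l) (hla : IsAffineFun l) {S : Set (E × ℝ)} (hS : Convex ℝ S)
    (hSc : IsCompact S) (hSne : S.Nonempty) (hSl : ∀ p ∈ S, ∃ x : K, (x : E) = p.1 ∧ p.2 < l x) :
    ∃ g : K → ℝ, Continuous g ∧ IsAffineFun g ∧ (∀ x : K, ∀ s, ((x : E), s) ∈ S → s < g x) ∧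
      ∀ x, g x < l x := by
  let C : Set (E × ℝ) := {p | ∃ x : K, (x : E) = p.1 ∧ l x ≤ p.2}
  have hCc : IsClosed C := by
    have h1 : IsClosedEmbedding (fun p : K × ℝ => ((p.1 : E), p.2)) :=
      (hK.isClosed.isClosedEmbedding_subtypeVal).prodMap IsClosedEmbedding.id
    have h2 := h1.isClosedMap _ hl.isClosed_epigraph
    convert h2 using 1
    ext ⟨x, t⟩
    simp only [C, mem_ofPred_eq, mem_image, Prod.exists, Prod.mk.injEq]
    constructor
    · rintro ⟨y, rfl, hy⟩
      exact ⟨y, t, hy, rfl, rfl⟩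
    · rintro ⟨y, t', hy, rfl, rfl⟩
      exact ⟨y, rfl, hy⟩
  have hC : Convex ℝ C := by
    rintro ⟨_, s⟩ ⟨x, rfl, hx⟩ ⟨_, t⟩ ⟨y, rfl, hy⟩ a b ha hb hab
    refine ⟨⟨a • (x : E) + b • (y : E), hconv x.2 y.2 ha hb hab⟩, rfl, ?_⟩
    rw [hla x y _ a b ha hb hab rfl]
    exact add_le_add (mul_le_mul_of_nonneg_left hx ha) (mul_le_mul_of_nonneg_left hy hb)
  have hdisj : Disjoint S C := by
    rw [Set.disjoint_left]
    intro p hp ⟨y, hy, hpy⟩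
    obtain ⟨x, hx, hpx⟩ := hSl p hp
    obtain rfl : x = y := Subtype.ext (hx.trans hy.symm)
    linarith
  have hov : ∃ x s t, (x, s) ∈ S ∧ (x, t) ∈ C := by
    obtain ⟨⟨p, s⟩, hp⟩ := hSne
    obtain ⟨x, hx, -⟩ := hSl _ hp
    exact ⟨p, s, l x, hp, x, hx, le_rfl⟩
  obtain ⟨g, hgc, hga, hgS, hgC⟩ := exists_affine_between (K := K) hS hSc hC hCc
    (fun x t t' ⟨y, hy, hyt⟩ ht => ⟨y, hy, hyt.trans ht⟩) hdisj hov
  exact ⟨fun x => g x, hgc.comp continuous_subtype_val, hga, fun x s hs => hgS _ _ hs,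
    fun x => hgC _ _ ⟨x, rfl, le_rfl⟩⟩

/-- As `l` is affine, the convex join of the two graphs still lies strictly below `l`. This supplies
directedness although two affine functions need not have an affine supremum. -/
theorem exists_affine_between_lsc (hK : IsCompact K) (hconv : Convex ℝ K) (hne : K.Nonempty)
    {l : K → ℝ} (hl : LowerSemicontinuous l) (hla : IsAffineFun l) {f₁ f₂ : K → ℝ}
    (hf₁ : Continuous f₁) (ha₁ : IsAffineFun f₁) (hf₂ : Continuous f₂) (ha₂ : IsAffineFun f₂)
    (h₁ : ∀ x, f₁ x < l x) (h₂ : ∀ x, f₂ x < l x) :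
    ∃ g : K → ℝ, Continuous g ∧ IsAffineFun g ∧ (∀ x, f₁ x < g x) ∧ (∀ x, f₂ x < g x) ∧
      ∀ x, g x < l x := by
  have : Nonempty K := hne.to_subtype
  have hn₁ : (graphSet f₁).Nonempty := range_nonempty _
  have hn₂ : (graphSet f₂).Nonempty := range_nonempty _
  obtain ⟨g, hgc, hga, hgS, hgl⟩ := exists_affine_below_lsc hK hconv hl hla
    ((convex_graphSet hconv ha₁).convexJoin (convex_graphSet hconv ha₂))
    (isCompact_convexJoin (isCompact_graphSet hK hf₁) (isCompact_graphSet hK hf₂))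
    (hn₁.mono (subset_convexJoin_left hn₂)) (by
      intro p hp
      rw [mem_convexJoin] at hp
      obtain ⟨_, ⟨x, rfl⟩, _, ⟨y, rfl⟩, a, b, ha, hb, hab, rfl⟩ := hp
      refine ⟨⟨a • (x : E) + b • (y : E), hconv x.2 y.2 ha hb hab⟩, rfl, ?_⟩
      rw [hla x y _ a b ha hb hab rfl]
      simp only [Prod.smul_mk, Prod.mk_add_mk, smul_eq_mul]
      have hx := h₁ x
      have hy := h₂ y
      rcases ha.eq_or_lt with rfl | ha
      · obtain rfl : b = 1 := by linarith
        simpa using hy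
      · nlinarith)
  exact ⟨g, hgc, hga, fun x => hgS _ _ (subset_convexJoin_left hn₂ ⟨x, rfl⟩),
    fun x => hgS _ _ (subset_convexJoin_right hn₁ ⟨x, rfl⟩), hgl⟩

theorem exists_affine_approx_lsc (hK : IsCompact K) (hconv : Convex ℝ K)
    {l : K → ℝ} (hl : LowerSemicontinuous l) (hla : IsAffineFun l) {x : K} {r : ℝ}
    (hr : r < l x) :
    ∃ g : K → ℝ, Continuous g ∧ IsAffineFun g ∧ r < g x ∧ ∀ x, g x < l x := by
  obtain ⟨g, hgc, hga, hgS, hgl⟩ := exists_affine_below_lsc hK hconv hl hla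
    (convex_singleton ((x : E), r)) isCompact_singleton (singleton_nonempty _)
    (by rintro _ rfl; exact ⟨x, rfl, hr⟩)
  exact ⟨g, hgc, hga, hgS x r rfl, hgl⟩

/-- At an extreme point, a continuous affine function and a compact convex set can be dominated
by a continuous affine function without increasing the value at that point by much. -/
theorem exists_affine_above_at_extBd (hK : IsCompact K) (hconv : Convex ℝ K)
    {ψ : K} (hψ : ψ ∈ extBd K) {f : K → ℝ} (hf : Continuous f) (hfa : IsAffineFun f) {t : ℝ}
    (hft : f ψ < t) {S : Set (E × ℝ)} (hS : Convex ℝ S) (hSc : IsCompact S)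
    (hSne : S.Nonempty) (hSK : ∀ p ∈ S, p.1 ∈ K) (hSt : ∀ s, ((ψ : E), s) ∈ S → s < t) :
    ∃ g : K → ℝ, Continuous g ∧ IsAffineFun g ∧ (∀ x, f x < g x) ∧
      (∀ x : K, ∀ s, ((x : E), s) ∈ S → s < g x) ∧ g ψ < t := by
  have hn₁ : (graphSet f).Nonempty := ⟨_, ψ, rfl⟩
  obtain ⟨g, hgc, hga, hgS, hgl⟩ := exists_affine_between (K := K)
    (A := convexJoin ℝ (graphSet f) S) (C := {(ψ : E)} ×ˢ Ici t)
    ((convex_graphSet hconv hfa).convexJoin hS)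
    (isCompact_convexJoin (isCompact_graphSet hK hf) hSc)
    ((convex_singleton _).prod (convex_Ici t)) (isClosed_singleton.prod isClosed_Ici)
    (fun x s s' h hs => ⟨h.1, le_trans h.2 hs⟩)
    (by
      rw [Set.disjoint_left]
      intro p hp hpC
      rw [mem_convexJoin] at hp
      obtain ⟨_, ⟨x, rfl⟩, ⟨y, s⟩, hy, a, b, ha, hb, hab, rfl⟩ := hp
      obtain ⟨h1, h2⟩ := hpC
      simp only [Prod.smul_mk, Prod.mk_add_mk, smul_eq_mul, mem_singleton_iff, mem_Ici] at h1 h2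
      rcases ha.eq_or_lt with rfl | ha
      · obtain rfl : b = 1 := by linarith
        simp only [zero_smul, one_smul, zero_add] at h1
        subst h1
        have := hSt s hy
        linarith
      rcases hb.eq_or_lt with rfl | hb
      · obtain rfl : a = 1 := by linarith
        simp only [zero_smul, one_smul, add_zero] at h1
        obtain rfl : x = ψ := Subtype.ext h1
        linarith
      -- A proper convex combination lying over the extreme point `ψ` has both endpoints over `ψ`,
      -- where the heights are below `t`.
      · have hx : (x : E) = ψ := hψ.2 x.2 (hSK _ hy) ⟨a, b, ha, hb, hab, h1⟩
        have hy' : y = ψ := hψ.2 (hSK _ hy) x.2 ⟨b, a, hb, ha, by linarith, by rw [add_comm, h1]⟩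
        subst hy'
        obtain rfl : x = ψ := Subtype.ext hx
        have h3 := mul_lt_mul_of_pos_left (hSt s hy) hb
        have h4 := mul_lt_mul_of_pos_left hft ha
        have h5 : a * t + b * t = t := by rw [← add_mul, hab, one_mul]
        linarith)
    ⟨ψ, f ψ, t, subset_convexJoin_left hSne ⟨ψ, rfl⟩, rfl, le_refl t⟩
  exact ⟨fun x => g x, hgc.comp continuous_subtype_val, hga,
    fun x => hgS _ _ (subset_convexJoin_left hSne ⟨x, rfl⟩),
    fun x s hs => hgS _ _ (subset_convexJoin_right hn₁ hs), hgl _ _ ⟨rfl, le_refl t⟩⟩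

end Separation

/-! ### Faces and extreme points -/

section Faces

variable [IsTopologicalAddGroup E] [ContinuousSMul ℝ E] [LocallyConvexSpace ℝ E] [T2Space E]

/-- A nonempty compact set has an extreme point, and extreme points of a face are extreme in `K`. -/
theorem exists_extBd_mem_of_face (hK : IsCompact K) {S : Set K} (hne : S.Nonempty)
    (hcl : IsClosed S) (hface : ∀ x y z : K, ∀ a b : ℝ, 0 < a → 0 < b → a + b = 1 →
      (z : E) = a • (x : E) + b • (y : E) → z ∈ S → x ∈ S) :
    ∃ ψ ∈ extBd K, ψ ∈ S := by
  have := isCompact_iff_compactSpace.1 hK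
  have hSc : IsCompact ((↑) '' S : Set E) := hcl.isCompact.image continuous_subtype_val
  obtain ⟨ψ, hψ⟩ := hSc.extremePoints_nonempty (hne.image _)
  have hext : IsExtreme ℝ K ((↑) '' S : Set E) := by
    refine ⟨by rintro _ ⟨x, -, rfl⟩; exact x.2, ?_⟩
    rintro x hx y hy _ ⟨z, hz, rfl⟩ ⟨a, b, ha, hb, hab, h⟩
    exact ⟨⟨x, hx⟩, hface ⟨x, hx⟩ ⟨y, hy⟩ z a b ha hb hab h.symm hz, rfl⟩
  obtain ⟨z, hz, rfl⟩ := hψ.1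
  exact ⟨z, hext.extremePoints_subset_extremePoints hψ, hz⟩

/-- Bauer's maximum principle for upper semicontinuous affine functions. -/
theorem exists_extBd_max (hK : IsCompact K) (hne : K.Nonempty) {u : K → ℝ}
    (hu : UpperSemicontinuous u) (hua : IsAffineFun u) : ∃ ψ ∈ extBd K, ∀ x, u x ≤ u ψ := by
  have := isCompact_iff_compactSpace.1 hK
  have := hne.to_subtype
  obtain ⟨x₀, -, hx₀⟩ := (hu.upperSemicontinuousOn univ).exists_isMaxOn univ_nonempty
    isCompact_univ
  have hmax : ∀ x, u x ≤ u x₀ := fun x => hx₀ (mem_univ x)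
  obtain ⟨ψ, hψ, hψS⟩ := exists_extBd_mem_of_face hK (S := u ⁻¹' Ici (u x₀)) ⟨x₀, le_refl (u x₀)⟩
    (hu.isClosed_preimage _) (by
      intro x y z a b ha hb hab hz hzS
      have h1 := hua x y z a b ha.le hb.le hab hz
      have h2 : u x₀ ≤ u z := hzS
      show u x₀ ≤ u x
      by_contra h
      push Not at h
      have h3 := mul_lt_mul_of_pos_left h ha
      have h4 := mul_le_mul_of_nonneg_left (hmax y) hb.le
      have h5 : a * u x₀ + b * u x₀ = u x₀ := by rw [← add_mul, hab, one_mul]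
      linarith)
  exact ⟨ψ, hψ, fun x => (hmax x).trans hψS⟩

theorem Ac.le_of_le_on_extBd (hK : IsCompact K) {f g : Ac K}
    (h : ∀ ψ ∈ extBd K, f.1 ψ ≤ g.1 ψ) : f ≤ g := by
  intro x
  obtain ⟨ψ, hψ, hmax⟩ := exists_extBd_max hK ⟨x, x.2⟩
    (f.2.1.sub g.2.1).upperSemicontinuous (f.2.2.1.sub g.2.2.1)
  have h1 := h ψ hψ
  have h2 : f.1 x - g.1 x ≤ f.1 ψ - g.1 ψ := hmax x
  show f.1 x ≤ g.1 x
  linarith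

theorem Ac.eq_of_eq_on_extBd (hK : IsCompact K) {f g : Ac K}
    (h : ∀ ψ ∈ extBd K, f.1 ψ = g.1 ψ) : f = g :=
  le_antisymm (Ac.le_of_le_on_extBd hK fun ψ hψ => (h ψ hψ).le)
    (Ac.le_of_le_on_extBd hK fun ψ hψ => (h ψ hψ).ge)

end Faces

/-! ### Elementary operations on `Ac K` -/

/-- Multiplication of an element of `Ac K` by a positive scalar. -/
def Ac.scale (r : ℝ) (hr : 0 < r) (f : Ac K) : Ac K :=
  ⟨fun x => r * f.1 x, continuous_const.mul f.2.1, by simpa using f.2.2.1.mul_add r 0,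
    fun x => mul_pos hr (f.2.2.2 x)⟩

@[simp] theorem Ac.scale_apply (r : ℝ) (hr : 0 < r) (f : Ac K) (x : K) :
    (Ac.scale r hr f).1 x = r * f.1 x := rfl

@[simp] theorem unit_apply (x : K) : (unit K).1 x = 1 := rfl

theorem Ac.exists_pos_le (hK : IsCompact K) (f : Ac K) : ∃ ε > 0, ∀ x, ε ≤ f.1 x := by
  have := isCompact_iff_compactSpace.1 hK
  rcases isEmpty_or_nonempty K with h | h
  · exact ⟨1, one_pos, fun x => h.elim x⟩
  · obtain ⟨x₀, -, hx₀⟩ := isCompact_univ.exists_isMinOn (univ_nonempty (α := K))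
      f.2.1.continuousOn
    exact ⟨f.1 x₀, f.2.2.2 x₀, fun x => hx₀ (mem_univ x)⟩

theorem Ac.exists_le_const (hK : IsCompact K) (f : Ac K) : ∃ C > 0, ∀ x, f.1 x ≤ C := by
  have := isCompact_iff_compactSpace.1 hK
  rcases isEmpty_or_nonempty K with h | h
  · exact ⟨1, one_pos, fun x => h.elim x⟩
  · obtain ⟨x₀, -, hx₀⟩ := isCompact_univ.exists_isMaxOn (univ_nonempty (α := K))
      f.2.1.continuousOn
    exact ⟨f.1 x₀, f.2.2.2 x₀, fun x => hx₀ (mem_univ x)⟩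

theorem Ac.exists_scale_le (hK : IsCompact K) {f g : Ac K} (h : ∀ x, f.1 x < g.1 x) :
    ∃ r > 1, ∀ x, r * f.1 x ≤ g.1 x := by
  have := isCompact_iff_compactSpace.1 hK
  rcases isEmpty_or_nonempty K with h' | h'
  · exact ⟨2, one_lt_two, fun x => h'.elim x⟩
  · obtain ⟨x₀, -, hx₀⟩ := isCompact_univ.exists_isMinOn (univ_nonempty (α := K))
      (f := fun x => g.1 x / f.1 x)
      (g.2.1.div f.2.1 fun x => (f.2.2.2 x).ne').continuousOn
    refine ⟨g.1 x₀ / f.1 x₀, (one_lt_div (f.2.2.2 x₀)).2 (h x₀), fun x => ?_⟩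
    have := hx₀ (mem_univ x)
    exact (le_div_iff₀ (f.2.2.2 x)).1 this

/-! ### Dini-type arguments -/

/-- The sets `{u < f}` are open by semicontinuity and form a directed cover of `K`, so a single one
covers. -/
theorem exists_mem_forall_lt_of_directed (hK : IsCompact K) {D : Set (Ac K)} (hD : D.Nonempty)
    (hdir : DirectedOn (· ≤ ·) D) {u : K → ℝ} (hu : UpperSemicontinuous u)
    (h : ∀ x, ∃ f ∈ D, u x < f.1 x) : ∃ f ∈ D, ∀ x, u x < f.1 x := by
  have := isCompact_iff_compactSpace.1 hK
  have := hD.to_subtype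
  obtain ⟨f, hf⟩ := isCompact_univ.elim_directed_cover (fun f : D => {x : K | u x < f.1.1 x})
    (by
      intro f
      rw [isOpen_iff_mem_nhds]
      intro x hx
      obtain ⟨c, hc₁, hc₂⟩ := exists_between (show u x < f.1.1 x from hx)
      filter_upwards [hu x c hc₁, f.1.2.1.continuousAt.eventually (lt_mem_nhds hc₂)] with y h1 h2
      exact h1.trans h2)
    (by
      intro x _
      obtain ⟨f, hf, hx⟩ := h x
      exact mem_iUnion.2 ⟨⟨f, hf⟩, hx⟩)
    (by
      rintro ⟨f, hf⟩ ⟨g, hg⟩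
      obtain ⟨k, hk, h1, h2⟩ := hdir f hf g hg
      exact ⟨⟨k, hk⟩, fun x hx => lt_of_lt_of_le hx (h1 x), fun x hx => lt_of_lt_of_le hx (h2 x)⟩)
  exact ⟨f.1, f.2, fun x => hf (mem_univ x)⟩

theorem exists_mem_forall_gt_of_directed (hK : IsCompact K) {D : Set (Ac K)} (hD : D.Nonempty)
    (hdir : DirectedOn (· ≥ ·) D) {l : K → ℝ} (hl : LowerSemicontinuous l)
    (h : ∀ x, ∃ f ∈ D, f.1 x < l x) : ∃ f ∈ D, ∀ x, f.1 x < l x := by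
  have := isCompact_iff_compactSpace.1 hK
  have := hD.to_subtype
  obtain ⟨f, hf⟩ := isCompact_univ.elim_directed_cover (fun f : D => {x : K | f.1.1 x < l x})
    (by
      intro f
      rw [isOpen_iff_mem_nhds]
      intro x hx
      obtain ⟨c, hc₁, hc₂⟩ := exists_between (show f.1.1 x < l x from hx)
      filter_upwards [hl x c hc₂, f.1.2.1.continuousAt.eventually (gt_mem_nhds hc₁)] with y h1 h2
      exact h2.trans h1)
    (by
      intro x _
      obtain ⟨f, hf, hx⟩ := h x
      exact mem_iUnion.2 ⟨⟨f, hf⟩, hx⟩)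
    (by
      rintro ⟨f, hf⟩ ⟨g, hg⟩
      obtain ⟨k, hk, h1, h2⟩ := hdir f hf g hg
      exact ⟨⟨k, hk⟩, fun x hx => lt_of_le_of_lt (h1 x) hx, fun x hx => lt_of_le_of_lt (h2 x) hx⟩)
  exact ⟨f.1, f.2, fun x => hf (mem_univ x)⟩

/-! ### Directed lower sets in `Ac K` -/

section LowerSets

variable [IsTopologicalAddGroup E] [ContinuousSMul ℝ E] [LocallyConvexSpace ℝ E] [T2Space E]

theorem exists_Ac_above_at_extBd (hK : IsCompact K) (hconv : Convex ℝ K) {ψ : K}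
    (hψ : ψ ∈ extBd K) {f g : Ac K} {t : ℝ} (hf : f.1 ψ < t) (hg : g.1 ψ < t) :
    ∃ k : Ac K, f ≤ k ∧ g ≤ k ∧ k.1 ψ < t := by
  obtain ⟨k, hkc, hka, h1, h2, h3⟩ := exists_affine_above_at_extBd hK hconv hψ f.2.1 f.2.2.1 hf
    (convex_graphSet hconv g.2.2.1) (isCompact_graphSet hK g.2.1) ⟨_, ψ, rfl⟩
    (by rintro _ ⟨x, rfl⟩; exact x.2)
    (by
      rintro s ⟨x, hx⟩
      obtain ⟨hx1, rfl⟩ := Prod.mk.inj hx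
      obtain rfl : x = ψ := Subtype.ext hx1
      exact hg)
  exact ⟨⟨k, hkc, hka, fun x => (f.2.2.2 x).trans (h1 x)⟩, fun x => (h1 x).le,
    fun x => (h2 x _ ⟨x, rfl⟩).le, h3⟩

/-- The compact set to be dominated is the single point `(x, N)`. Functions small at `ψ` are thus
unbounded at every other point. -/
theorem exists_Ac_large_off_extBd (hK : IsCompact K) (hconv : Convex ℝ K) {ψ : K}
    (hψ : ψ ∈ extBd K) {x : K} (hx : x ≠ ψ) {t : ℝ} (ht : 0 < t) (N : ℝ) :
    ∃ k : Ac K, k.1 ψ < t ∧ N < k.1 x := by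
  obtain ⟨k, hkc, hka, h1, h2, h3⟩ := exists_affine_above_at_extBd hK hconv hψ
    (Ac.scale (t / 2) (half_pos ht) (unit K)).2.1
    (Ac.scale (t / 2) (half_pos ht) (unit K)).2.2.1 (t := t) (by simp; linarith)
    (convex_singleton ((x : E), N)) isCompact_singleton (singleton_nonempty _)
    (by rintro _ rfl; exact x.2)
    (by
      rintro s hs
      exact absurd (Subtype.ext (Prod.mk.inj hs).1.symm) hx)
  exact ⟨⟨k, hkc, hka, fun x => ((Ac.scale _ (half_pos ht) (unit K)).2.2.2 x).trans (h1 x)⟩, h3,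
    h2 x N rfl⟩

theorem extBd_eq_of_le (hK : IsCompact K) (hconv : Convex ℝ K) {ψ : K}
    (hψ : ψ ∈ extBd K) {x : K} {c : ℝ} (h : ∀ f : Ac K, f.1 ψ < 1 → f.1 x ≤ c) : x = ψ := by
  by_contra hx
  obtain ⟨k, h1, h2⟩ := exists_Ac_large_off_extBd hK hconv hψ hx one_pos c
  exact absurd (h k h1) (not_le.2 h2)

/-- A proper directed lower set is bounded at some extreme point. -/
theorem exists_extBd_bound (hK : IsCompact K) {D : Set (Ac K)}
    (hD : D.Nonempty) (hlow : IsLowerSet D) (hdir : DirectedOn (· ≤ ·) D) {f₀ : Ac K}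
    (hf₀ : f₀ ∉ D) : ∃ ψ ∈ extBd K, ∃ c > 0, ∀ f ∈ D, f.1 ψ ≤ c := by
  have := isCompact_iff_compactSpace.1 hK
  -- Otherwise the Dini argument gives one member of `D` above `f₀`, contradicting `f₀ ∉ D`.
  obtain ⟨x₀, hx₀⟩ : ∃ x, ∀ f ∈ D, f.1 x ≤ f₀.1 x := by
    by_contra hcon
    push Not at hcon
    obtain ⟨f, hf, hlt⟩ := exists_mem_forall_lt_of_directed hK hD hdir
      f₀.2.1.upperSemicontinuous hcon
    exact hf₀ (hlow (fun x => (hlt x).le) hf)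
  have := hD.to_subtype
  have : Nonempty K := ⟨x₀⟩
  -- The pointwise supremum may be infinite; it is lower semicontinuous, hence attains its minimum,
  -- which is finite because of `x₀`.
  let h : K → EReal := fun x => ⨆ f : D, ((f.1.1 x : ℝ) : EReal)
  have hle : ∀ x (c : ℝ), h x ≤ c ↔ ∀ f ∈ D, f.1 x ≤ c := by
    intro x c
    simp only [h, iSup_le_iff, EReal.coe_le_coe_iff, Subtype.forall]
  have hlsc : LowerSemicontinuous h := lowerSemicontinuous_iSup fun f =>
    (continuous_coe_real_ereal.comp f.1.2.1).lowerSemicontinuous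
  obtain ⟨x₁, -, hx₁⟩ := (hlsc.lowerSemicontinuousOn univ).exists_isMinOn univ_nonempty
    isCompact_univ
  have hmin : ∀ x, h x₁ ≤ h x := fun x => hx₁ (mem_univ x)
  obtain ⟨c, hc⟩ : ∃ c : ℝ, h x₁ = c := by
    obtain ⟨f, hf⟩ := hD
    have h1 : h x₁ ≤ (f₀.1 x₀ : ℝ) := (hmin x₀).trans ((hle _ _).2 hx₀)
    have h2 : ((f.1 x₁ : ℝ) : EReal) ≤ h x₁ :=
      le_iSup (fun f : D => ((f.1.1 x₁ : ℝ) : EReal)) ⟨f, hf⟩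
    have h3 : h x₁ ≠ ⊤ := (h1.trans_lt (EReal.coe_lt_top _)).ne
    have h4 : h x₁ ≠ ⊥ := ((EReal.bot_lt_coe _).trans_le h2).ne'
    exact ⟨(h x₁).toReal, (EReal.coe_toReal h3 h4).symm⟩
  have hlb : ∀ x, ∀ c' < c, ∃ f ∈ D, c' < f.1 x := by
    intro x c' hc'
    by_contra hcon
    push Not at hcon
    have h1 := (hmin x).trans ((hle x c').2 hcon)
    rw [hc, EReal.coe_le_coe_iff] at h1
    linarith
  -- The points where `h` is minimal form a closed face: if some `f ∈ D` exceeded `c` at `x`, a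
  -- common upper bound of `f` and of a member almost `c` at `y` would exceed `c` at `z`.
  obtain ⟨ψ, hψ, hψS⟩ := exists_extBd_mem_of_face hK (S := {x | ∀ f ∈ D, f.1 x ≤ c})
    ⟨x₁, (hle _ _).1 hc.le⟩
    (by
      have : {x : K | ∀ f ∈ D, f.1 x ≤ c} = ⋂ f ∈ D, {x | f.1 x ≤ c} := by ext; simp
      rw [this]
      exact isClosed_biInter fun f _ => isClosed_le f.2.1 continuous_const)
    (by
      intro x y z a b ha hb hab hz hzS f hf
      by_contra hcon
      push Not at hcon
      -- The weighted loss `b * δ` at `y` must stay below the weighted gain at `x`.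
      obtain ⟨δ, hδ, hδ'⟩ : ∃ δ > 0, b * δ < a * (f.1 x - c) :=
        ⟨a * (f.1 x - c) / (2 * b), by
          have := mul_pos ha (sub_pos.2 hcon)
          positivity, by
          have := mul_pos ha (sub_pos.2 hcon)
          have h2 : b * (a * (f.1 x - c) / (2 * b)) = a * (f.1 x - c) / 2 := by field_simp
          linarith⟩
      obtain ⟨g, hg, hgy⟩ := hlb y (c - δ) (by linarith)
      obtain ⟨k, hk, h1, h2⟩ := hdir f hf g hg
      have h3 := k.2.2.1 x y z a b ha.le hb.le hab hz
      have h4 := hzS k hk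
      have h5 : a * f.1 x ≤ a * k.1 x := mul_le_mul_of_nonneg_left (h1 x) ha.le
      have h6 : b * g.1 y ≤ b * k.1 y := mul_le_mul_of_nonneg_left (h2 y) hb.le
      have h7 := mul_lt_mul_of_pos_left hgy hb
      have h8 : a * c + b * c = c := by rw [← add_mul, hab, one_mul]
      nlinarith)
  obtain ⟨f, hf⟩ := hD
  exact ⟨ψ, hψ, c, (f.2.2.2 ψ).trans_le (hψS f hf), hψS⟩

/-- A proper directed lower set that contains all functions small at an extreme point is
determined, up to its boundary, by a bound at that point. -/
theorem exists_bound_iff (hK : IsCompact K) (hconv : Convex ℝ K) {ψ : K} (hψ : ψ ∈ extBd K)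
    {D : Set (Ac K)} (hlow : IsLowerSet D) (hdir : DirectedOn (· ≤ ·) D) {f₀ : Ac K}
    (hf₀ : f₀ ∉ D) {ε : ℝ} (hε : 0 < ε) (hsub : ∀ f : Ac K, f.1 ψ < ε → f ∈ D) :
    ∃ c > 0, (∀ f : Ac K, f.1 ψ < c → f ∈ D) ∧ ∀ f ∈ D, f.1 ψ ≤ c := by
  have hD : D.Nonempty := ⟨Ac.scale (ε / 2) (half_pos hε) (unit K), hsub _ (by simp; linarith)⟩
  obtain ⟨χ, -, C, hC, hb⟩ := exists_extBd_bound hK hD hlow hdir hf₀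
  obtain rfl : χ = ψ := by
    by_contra hne
    obtain ⟨k, h1, h2⟩ := exists_Ac_large_off_extBd hK hconv hψ hne hε C
    exact absurd (hb k (hsub k h1)) (not_le.2 h2)
  have hbdd : BddAbove ((fun f : Ac K => f.1 χ) '' D) := ⟨C, by rintro _ ⟨f, hf, rfl⟩; exact hb f hf⟩
  set c := sSup ((fun f : Ac K => f.1 χ) '' D)
  have hle : ∀ f ∈ D, f.1 χ ≤ c := fun f hf => le_csSup hbdd ⟨f, hf, rfl⟩
  refine ⟨c, ?_, ?_, hle⟩
  · obtain ⟨f, hf⟩ := hD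
    exact (f.2.2.2 χ).trans_le (hle f hf)
  · intro f hf
    obtain ⟨g, hg, hlt⟩ := exists_mem_forall_lt_of_directed hK hD hdir
      f.2.1.upperSemicontinuous (by
        intro x
        by_cases hx : x = χ
        · subst hx
          obtain ⟨_, ⟨g, hg, rfl⟩, hlt⟩ := exists_lt_of_lt_csSup (hD.image _) hf
          exact ⟨g, hg, hlt⟩
        · obtain ⟨k, h1, h2⟩ := exists_Ac_large_off_extBd hK hconv hψ hx hε (f.1 x)
          exact ⟨k, hsub k h1, h2⟩)
    exact hlow (fun x => (hlt x).le) hg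

end LowerSets

/-! ### Semicontinuous affine functions and directed families -/

/-- The positive lower semicontinuous affine functions on `K`. -/
def AlscPos (K : Set E) : Set (K → ℝ) :=
  {l | LowerSemicontinuous l ∧ IsAffineFun l ∧ ∀ x, 0 < l x}

/-- The continuous affine functions strictly below `l`. -/
def Below (l : K → ℝ) : Set (Ac K) := {f | ∀ x, f.1 x < l x}

/-- The continuous affine functions strictly above `u`. -/
def Above (u : K → ℝ) : Set (Ac K) := {f | ∀ x, u x < f.1 x}

/-- Directedness yields one member that is nearly infimal at both endpoints of a segment; this is
why the infimum is affine and not merely concave. -/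
theorem exists_inf_mem_Ausc {D : Set (Ac K)} (hD : D.Nonempty) (hdir : DirectedOn (· ≥ ·) D) :
    ∃ u ∈ Ausc K, (∀ g ∈ D, ∀ x, u x ≤ g.1 x) ∧ ∀ x r, u x < r → ∃ g ∈ D, g.1 x < r := by
  set u : K → ℝ := fun x => sInf ((fun g : Ac K => g.1 x) '' D)
  have hbdd : ∀ x, BddBelow ((fun g : Ac K => g.1 x) '' D) := fun x =>
    ⟨0, by rintro _ ⟨g, -, rfl⟩; exact (g.2.2.2 x).le⟩
  have hle : ∀ g ∈ D, ∀ x, u x ≤ g.1 x := fun g hg x => csInf_le (hbdd x) ⟨g, hg, rfl⟩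
  have hlt : ∀ x r, u x < r → ∃ g ∈ D, g.1 x < r := by
    intro x r hr
    obtain ⟨_, ⟨g, hg, rfl⟩, h⟩ := exists_lt_of_csInf_lt (hD.image _) hr
    exact ⟨g, hg, h⟩
  refine ⟨u, ⟨?_, ?_, ?_⟩, hle, hlt⟩
  · intro x r hr
    obtain ⟨g, hg, h⟩ := hlt x r hr
    filter_upwards [g.2.1.continuousAt.eventually (gt_mem_nhds h)] with y hy
    exact (hle g hg y).trans_lt hy
  · intro x y z a b ha hb hab hz
    apply le_antisymm
    · refine le_of_forall_pos_le_add fun ε hε => ?_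
      obtain ⟨g₁, hg₁, h₁⟩ := hlt x (u x + ε) (by linarith)
      obtain ⟨g₂, hg₂, h₂⟩ := hlt y (u y + ε) (by linarith)
      obtain ⟨g, hg, h3, h4⟩ := hdir g₁ hg₁ g₂ hg₂
      have h5 := g.2.2.1 x y z a b ha hb hab hz
      have h6 := mul_le_mul_of_nonneg_left ((h3 x).trans h₁.le) ha
      have h7 := mul_le_mul_of_nonneg_left ((h4 y).trans h₂.le) hb
      have h8 := hle g hg z
      have h9 : a * ε + b * ε = ε := by rw [← add_mul, hab, one_mul]
      nlinarith
    · refine le_of_forall_gt fun r hr => ?_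
      obtain ⟨g, hg, h⟩ := hlt z r hr
      have h5 := g.2.2.1 x y z a b ha hb hab hz
      have h6 := mul_le_mul_of_nonneg_left (hle g hg x) ha
      have h7 := mul_le_mul_of_nonneg_left (hle g hg y) hb
      linarith
  · intro x
    by_contra hneg
    push Not at hneg
    obtain ⟨g, -, h⟩ := hlt x 0 hneg
    exact (g.2.2.2 x).not_gt h

theorem exists_sup_mem_AlscPos {D : Set (Ac K)} (hD : D.Nonempty) (hdir : DirectedOn (· ≤ ·) D)
    {C : ℝ} (hC : ∀ f ∈ D, ∀ x, f.1 x ≤ C) :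
    ∃ l ∈ AlscPos K, (∀ f ∈ D, ∀ x, f.1 x ≤ l x) ∧ ∀ x r, r < l x → ∃ f ∈ D, r < f.1 x := by
  set l : K → ℝ := fun x => sSup ((fun g : Ac K => g.1 x) '' D)
  have hbdd : ∀ x, BddAbove ((fun g : Ac K => g.1 x) '' D) := fun x =>
    ⟨C, by rintro _ ⟨g, hg, rfl⟩; exact hC g hg x⟩
  have hle : ∀ g ∈ D, ∀ x, g.1 x ≤ l x := fun g hg x => le_csSup (hbdd x) ⟨g, hg, rfl⟩
  have hlt : ∀ x r, r < l x → ∃ g ∈ D, r < g.1 x := by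
    intro x r hr
    obtain ⟨_, ⟨g, hg, rfl⟩, h⟩ := exists_lt_of_lt_csSup (hD.image _) hr
    exact ⟨g, hg, h⟩
  refine ⟨l, ⟨?_, ?_, ?_⟩, hle, hlt⟩
  · intro x r hr
    obtain ⟨g, hg, h⟩ := hlt x r hr
    filter_upwards [g.2.1.continuousAt.eventually (lt_mem_nhds h)] with y hy
    exact hy.trans_le (hle g hg y)
  · intro x y z a b ha hb hab hz
    apply le_antisymm
    · refine le_of_forall_lt fun r hr => ?_
      obtain ⟨g, hg, h⟩ := hlt z r hr
      have h5 := g.2.2.1 x y z a b ha hb hab hz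
      have h6 := mul_le_mul_of_nonneg_left (hle g hg x) ha
      have h7 := mul_le_mul_of_nonneg_left (hle g hg y) hb
      linarith
    · refine le_of_forall_pos_le_add fun ε hε => ?_
      obtain ⟨g₁, hg₁, h₁⟩ := hlt x (l x - ε) (by linarith)
      obtain ⟨g₂, hg₂, h₂⟩ := hlt y (l y - ε) (by linarith)
      obtain ⟨g, hg, h3, h4⟩ := hdir g₁ hg₁ g₂ hg₂
      have h5 := g.2.2.1 x y z a b ha hb hab hz
      have h6 := mul_le_mul_of_nonneg_left (h₁.le.trans (h3 x)) ha
      have h7 := mul_le_mul_of_nonneg_left (h₂.le.trans (h4 y)) hb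
      have h8 := hle g hg z
      have h9 : a * ε + b * ε = ε := by rw [← add_mul, hab, one_mul]
      nlinarith
  · intro x
    obtain ⟨g, hg⟩ := hD
    exact (g.2.2.2 x).trans_le (hle g hg x)

theorem exists_const_lt_of_mem_AlscPos (hK : IsCompact K) (hne : K.Nonempty) {l : K → ℝ}
    (hl : l ∈ AlscPos K) : ∃ ε > 0, ∀ x, ε < l x := by
  have := isCompact_iff_compactSpace.1 hK
  have := hne.to_subtype
  obtain ⟨x₀, -, hx₀⟩ := (hl.1.lowerSemicontinuousOn univ).exists_isMinOn univ_nonempty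
    isCompact_univ
  have h0 := hl.2.2 x₀
  exact ⟨l x₀ / 2, half_pos h0, fun x => (half_lt_self h0).trans_le (hx₀ (mem_univ x))⟩

theorem exists_lt_const_of_mem_Ausc (hK : IsCompact K) (hne : K.Nonempty) {u : K → ℝ}
    (hu : u ∈ Ausc K) : ∃ C > 0, ∀ x, u x < C := by
  have := isCompact_iff_compactSpace.1 hK
  have := hne.to_subtype
  obtain ⟨x₀, -, hx₀⟩ := (hu.1.upperSemicontinuousOn univ).exists_isMaxOn univ_nonempty
    isCompact_univ
  exact ⟨u x₀ + 1, by linarith [hu.2.2 x₀], fun x => (lt_add_one _).trans_le' (hx₀ (mem_univ x))⟩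

theorem Below_nonempty (hK : IsCompact K) (hne : K.Nonempty) {l : K → ℝ} (hl : l ∈ AlscPos K) :
    (Below l).Nonempty := by
  obtain ⟨ε, hε, h⟩ := exists_const_lt_of_mem_AlscPos hK hne hl
  exact ⟨Ac.scale ε hε (unit K), fun x => by simpa using h x⟩

theorem Above_nonempty (hK : IsCompact K) (hne : K.Nonempty) {u : K → ℝ} (hu : u ∈ Ausc K) :
    (Above u).Nonempty := by
  obtain ⟨ε, hε, h⟩ := exists_lt_const_of_mem_Ausc hK hne hu
  exact ⟨Ac.scale ε hε (unit K), fun x => by simpa using h x⟩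

theorem isLowerSet_Below (l : K → ℝ) : IsLowerSet (Below l) :=
  fun _ _ hfg hf x => (hfg x).trans_lt (hf x)

theorem isUpperSet_Above (u : K → ℝ) : IsUpperSet (Above u) :=
  fun _ _ hfg hf x => (hf x).trans_le (hfg x)

/-! ### Approximation of semicontinuous affine functions by continuous ones -/

section Approximation

variable [IsTopologicalAddGroup E] [ContinuousSMul ℝ E] [LocallyConvexSpace ℝ E] [T2Space E]

/-- Separation only produces real-valued minorants; `f₁` may be negative, and `f₂` forces the result
to be positive. -/
theorem exists_Ac_between_Below (hK : IsCompact K) (hconv : Convex ℝ K) (hne : K.Nonempty)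
    {l : K → ℝ} (hl : l ∈ AlscPos K) {f₁ : K → ℝ} (hc : Continuous f₁) (ha : IsAffineFun f₁)
    (h₁ : ∀ x, f₁ x < l x) {f₂ : Ac K} (h₂ : f₂ ∈ Below l) :
    ∃ g ∈ Below l, (∀ x, f₁ x < g.1 x) ∧ ∀ x, f₂.1 x < g.1 x := by
  obtain ⟨g, hgc, hga, h1, h2, h3⟩ := exists_affine_between_lsc hK hconv hne hl.1 hl.2.1 hc
    ha f₂.2.1 f₂.2.2.1 h₁ h₂
  exact ⟨⟨g, hgc, hga, fun x => (f₂.2.2.2 x).trans (h2 x)⟩, h3, h1, h2⟩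

theorem directedOn_Below (hK : IsCompact K) (hconv : Convex ℝ K) (hne : K.Nonempty)
    {l : K → ℝ} (hl : l ∈ AlscPos K) : DirectedOn (· ≤ ·) (Below l) := by
  intro f hf g hg
  obtain ⟨k, hk, h1, h2⟩ := exists_Ac_between_Below hK hconv hne hl f.2.1 f.2.2.1 hf hg
  exact ⟨k, hk, fun x => (h1 x).le, fun x => (h2 x).le⟩

theorem exists_mem_Below_gt (hK : IsCompact K) (hconv : Convex ℝ K) (hne : K.Nonempty)
    {l : K → ℝ} (hl : l ∈ AlscPos K) {x : K} {r : ℝ} (hr : r < l x) :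
    ∃ f ∈ Below l, r < f.1 x := by
  obtain ⟨g, hgc, hga, hgx, hgl⟩ := exists_affine_approx_lsc hK hconv hl.1 hl.2.1 hr
  obtain ⟨f, hf⟩ := Below_nonempty hK hne hl
  obtain ⟨k, hk, h1, h2⟩ := exists_Ac_between_Below hK hconv hne hl hgc hga hgl hf
  exact ⟨k, hk, hgx.trans (h1 x)⟩

theorem exists_scale_mem_Below (hK : IsCompact K) (hconv : Convex ℝ K) (hne : K.Nonempty)
    {l : K → ℝ} (hl : l ∈ AlscPos K) {f : Ac K} (hf : f ∈ Below l) :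
    ∃ (r : ℝ) (hr : 1 < r), Ac.scale r (one_pos.trans hr) f ∈ Below l := by
  obtain ⟨k, hk, h1, -⟩ := exists_Ac_between_Below hK hconv hne hl f.2.1 f.2.2.1 hf hf
  obtain ⟨r, hr, h⟩ := Ac.exists_scale_le hK h1
  exact ⟨r, hr, fun x => (h x).trans_lt (hk x)⟩

theorem directedOn_Above (hK : IsCompact K) (hconv : Convex ℝ K) (hne : K.Nonempty)
    {u : K → ℝ} (hu : u ∈ Ausc K) : DirectedOn (· ≥ ·) (Above u) := by
  intro f hf g hg
  obtain ⟨k, hkc, hka, h1, h2, h3⟩ := exists_affine_between_lsc hK hconv hne hu.1.neg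
    hu.2.1.neg f.2.1.neg f.2.2.1.neg g.2.1.neg g.2.2.1.neg (fun x => neg_lt_neg (hf x))
    (fun x => neg_lt_neg (hg x))
  refine ⟨⟨fun x => -k x, hkc.neg, hka.neg, fun x => ?_⟩, fun x => ?_, fun x => ?_, fun x => ?_⟩
  · exact (hu.2.2 x).trans_lt (lt_neg_of_lt_neg (h3 x))
  · exact lt_neg_of_lt_neg (h3 x)
  · exact (neg_lt_of_neg_lt (h1 x)).le
  · exact (neg_lt_of_neg_lt (h2 x)).le

theorem exists_mem_Above_lt (hK : IsCompact K) (hconv : Convex ℝ K)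
    {u : K → ℝ} (hu : u ∈ Ausc K) {x : K} {r : ℝ} (hr : u x < r) :
    ∃ f ∈ Above u, f.1 x < r := by
  obtain ⟨k, hkc, hka, h1, h2⟩ := exists_affine_approx_lsc hK hconv hu.1.neg
    hu.2.1.neg (neg_lt_neg hr)
  refine ⟨⟨fun x => -k x, hkc.neg, hka.neg, fun x => ?_⟩, fun x => ?_, ?_⟩
  · exact (hu.2.2 x).trans_lt (lt_neg_of_lt_neg (h2 x))
  · exact lt_neg_of_lt_neg (h2 x)
  · exact neg_lt_of_neg_lt h1

theorem exists_lt_mem_Above (hK : IsCompact K) (hconv : Convex ℝ K) (hne : K.Nonempty)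
    {u : K → ℝ} (hu : u ∈ Ausc K) {f : Ac K} (hf : f ∈ Above u) :
    ∃ g ∈ Above u, ∀ x, g.1 x < f.1 x := by
  obtain ⟨k, hkc, hka, h1, -, h3⟩ := exists_affine_between_lsc hK hconv hne hu.1.neg
    hu.2.1.neg f.2.1.neg f.2.2.1.neg f.2.1.neg f.2.2.1.neg (fun x => neg_lt_neg (hf x))
    (fun x => neg_lt_neg (hf x))
  exact ⟨⟨fun x => -k x, hkc.neg, hka.neg, fun x =>
    (hu.2.2 x).trans_lt (lt_neg_of_lt_neg (h3 x))⟩, fun x => lt_neg_of_lt_neg (h3 x),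
    fun x => neg_lt_of_neg_lt (h1 x)⟩

theorem le_of_Below_subset (hK : IsCompact K) (hconv : Convex ℝ K) (hne : K.Nonempty)
    {l l' : K → ℝ} (hl : l ∈ AlscPos K) (h : Below l ⊆ Below l') (x : K) : l x ≤ l' x := by
  refine le_of_forall_lt fun r hr => ?_
  obtain ⟨f, hf, hfx⟩ := exists_mem_Below_gt hK hconv hne hl hr
  exact hfx.trans (h hf x)

theorem le_of_Above_subset (hK : IsCompact K) (hconv : Convex ℝ K)
    {u u' : K → ℝ} (hu : u ∈ Ausc K) (h : Above u ⊆ Above u') (x : K) : u' x ≤ u x := by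
  refine le_of_forall_gt fun r hr => ?_
  obtain ⟨f, hf, hfx⟩ := exists_mem_Above_lt hK hconv hu hr
  exact (h hf x).trans hfx

end Approximation

/-! ### Gauge-preserving and gauge-reversing maps in terms of the order -/

/-- The supremum is attained, so conditions on the gauge become plain inequalities between
functions. -/
theorem mul_le_iff_le_gaugeInf (hK : IsCompact K) (hne : K.Nonempty) (f g : Ac K) {r : ℝ}
    (hr : 0 < r) : (∀ x, r * g.1 x ≤ f.1 x) ↔ r ≤ gaugeInf f.1 g.1 := by
  obtain ⟨x₀⟩ := hne.to_subtype
  constructor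
  · intro h
    refine le_csSup ⟨f.1 x₀ / g.1 x₀, ?_⟩ ⟨hr, h⟩
    rintro s ⟨-, hs⟩
    exact (le_div_iff₀ (g.2.2.2 x₀)).2 (hs x₀)
  · intro h x
    obtain ⟨ε, hε, hεf⟩ := Ac.exists_pos_le hK f
    obtain ⟨C, hC, hCg⟩ := Ac.exists_le_const hK g
    have hle : gaugeInf f.1 g.1 ≤ f.1 x / g.1 x := by
      refine csSup_le ⟨ε / C, div_pos hε hC, fun y => ?_⟩ fun s hs => ?_
      -- `ε / C` witnesses that the set under the supremum is nonempty.
      · calc ε / C * g.1 y ≤ ε / C * C :=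
              mul_le_mul_of_nonneg_left (hCg y) (div_pos hε hC).le
          _ = ε := div_mul_cancel₀ _ hC.ne'
          _ ≤ f.1 y := hεf y
      · exact (le_div_iff₀ (g.2.2.2 x)).2 (hs.2 x)
    exact (le_div_iff₀ (g.2.2.2 x)).1 (h.trans hle)

/-- Order reversal together with homogeneity of degree `-1`. -/
def ScaleAntitone (Φ : Ac K ≃ Ac K) : Prop :=
  ∀ (f g : Ac K) (r : ℝ), 0 < r →
    ((∀ x, r * (Φ g).1 x ≤ (Φ f).1 x) ↔ ∀ x, r * f.1 x ≤ g.1 x)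

/-- Order preservation together with homogeneity of degree `1`. -/
def ScaleMonotone (Φ : Ac K ≃ Ac K) : Prop :=
  ∀ (f g : Ac K) (r : ℝ), 0 < r →
    ((∀ x, r * (Φ g).1 x ≤ (Φ f).1 x) ↔ ∀ x, r * g.1 x ≤ f.1 x)

theorem IsGaugeReversing.scaleAntitone (hK : IsCompact K) {Φ : Ac K ≃ Ac K}
    (h : IsGaugeReversing Φ) : ScaleAntitone Φ := by
  intro f g r hr
  rcases K.eq_empty_or_nonempty with rfl | hne
  · exact ⟨fun _ x => x.2.elim, fun _ x => x.2.elim⟩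
  · rw [mul_le_iff_le_gaugeInf hK hne _ _ hr, mul_le_iff_le_gaugeInf hK hne _ _ hr, h]

theorem IsGaugePreserving.scaleMonotone (hK : IsCompact K) {Φ : Ac K ≃ Ac K}
    (h : IsGaugePreserving Φ) : ScaleMonotone Φ := by
  intro f g r hr
  rcases K.eq_empty_or_nonempty with rfl | hne
  · exact ⟨fun _ x => x.2.elim, fun _ x => x.2.elim⟩
  · rw [mul_le_iff_le_gaugeInf hK hne _ _ hr, mul_le_iff_le_gaugeInf hK hne _ _ hr, h]

namespace ScaleMonotone

variable {Φ : Ac K ≃ Ac K}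

theorem symm (h : ScaleMonotone Φ) : ScaleMonotone Φ.symm := fun f g r hr => by
  simpa using (h (Φ.symm f) (Φ.symm g) r hr).symm

theorem le_iff (h : ScaleMonotone Φ) {f g : Ac K} : Φ f ≤ Φ g ↔ f ≤ g := by
  have := h g f 1 one_pos
  simp only [one_mul] at this
  exact this

theorem map_scale (h : ScaleMonotone Φ) {r : ℝ} (hr : 0 < r) (f : Ac K) :
    Φ (Ac.scale r hr f) = Ac.scale r hr (Φ f) := by
  apply le_antisymm
  · have h1 := (h f (Ac.scale r hr f) r⁻¹ (inv_pos.2 hr)).2 fun x => by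
      rw [Ac.scale_apply, inv_mul_cancel_left₀ hr.ne']
    exact fun x => (inv_mul_le_iff₀ hr).1 (h1 x)
  · exact (h (Ac.scale r hr f) f r hr).2 fun x => le_rfl

theorem directedOn_preimage (h : ScaleMonotone Φ)
    {D : Set (Ac K)} (hD : DirectedOn (· ≤ ·) D) : DirectedOn (· ≤ ·) {f | Φ f ∈ D} := by
  intro f hf g hg
  obtain ⟨k, hk, h1, h2⟩ := hD _ hf _ hg
  refine ⟨Φ.symm k, by simpa using hk, ?_, ?_⟩
  · exact h.le_iff.1 (by simpa using h1)
  · exact h.le_iff.1 (by simpa using h2)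

end ScaleMonotone

namespace ScaleAntitone

variable {Φ : Ac K ≃ Ac K}

theorem symm (h : ScaleAntitone Φ) : ScaleAntitone Φ.symm := fun f g r hr => by
  simpa using (h (Φ.symm g) (Φ.symm f) r hr).symm

theorem comp_self (h : ScaleAntitone Φ) : ScaleMonotone (Φ.trans Φ) := fun f g r hr =>
  (h (Φ f) (Φ g) r hr).trans (h g f r hr)

theorem le_iff (h : ScaleAntitone Φ) {f g : Ac K} : Φ f ≤ Φ g ↔ g ≤ f := by
  have := h g f 1 one_pos
  simp only [one_mul] at this
  exact this

theorem map_scale (h : ScaleAntitone Φ) {r : ℝ} (hr : 0 < r) (f : Ac K) :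
    Φ (Ac.scale r hr f) = Ac.scale r⁻¹ (inv_pos.2 hr) (Φ f) := by
  apply le_antisymm
  · have h1 := (h f (Ac.scale r hr f) r hr).2 fun x => le_rfl
    exact fun x => by
      rw [Ac.scale_apply, ← div_eq_inv_mul, le_div_iff₀ hr, mul_comm]
      exact h1 x
  · exact (h (Ac.scale r hr f) f r⁻¹ (inv_pos.2 hr)).2 fun x => by
      rw [Ac.scale_apply, inv_mul_cancel_left₀ hr.ne']

theorem directedOn_preimage_le (h : ScaleAntitone Φ) {D : Set (Ac K)}
    (hD : DirectedOn (· ≥ ·) D) : DirectedOn (· ≤ ·) {f | Φ f ∈ D} := by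
  intro f hf g hg
  obtain ⟨k, hk, h1, h2⟩ := hD _ hf _ hg
  refine ⟨Φ.symm k, by simpa using hk, ?_, ?_⟩
  · exact h.le_iff.1 (by simpa using h1)
  · exact h.le_iff.1 (by simpa using h2)

theorem directedOn_preimage_ge (h : ScaleAntitone Φ) {D : Set (Ac K)}
    (hD : DirectedOn (· ≤ ·) D) : DirectedOn (· ≥ ·) {f | Φ f ∈ D} := by
  intro f hf g hg
  obtain ⟨k, hk, h1, h2⟩ := hD _ hf _ hg
  refine ⟨Φ.symm k, by simpa using hk, ?_, ?_⟩
  · exact h.le_iff.1 (by simpa using h1)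
  · exact h.le_iff.1 (by simpa using h2)

end ScaleAntitone

/-! ### Duality between lower and upper semicontinuous functions -/

/-- `u` is the image of the lower semicontinuous function `l` under the extension of the
gauge-reversing map `Ψ`. -/
def IsDualPair (Ψ : Ac K ≃ Ac K) (l u : K → ℝ) : Prop :=
  ∀ f : Ac K, Ψ f ∈ Above u ↔ f ∈ Below l

theorem ScaleAntitone.map_const {Ψ : Ac K ≃ Ac K} (h : ScaleAntitone Ψ)
    (hunit : Ψ (unit K) = unit K) {c : ℝ} (hc : 0 < c) :
    Ψ (Ac.scale c hc (unit K)) = Ac.scale c⁻¹ (inv_pos.2 hc) (unit K) := by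
  rw [h.map_scale, hunit]

/-- `Ψ` sends the constant `c` to `c⁻¹`, so testing duality on constants exchanges bounds. -/
theorem IsDualPair.forall_le_iff {Ψ : Ac K ≃ Ac K} (h : ScaleAntitone Ψ)
    (hunit : Ψ (unit K) = unit K) {l u : K → ℝ} (hl : l ∈ AlscPos K) (hlu : IsDualPair Ψ l u)
    {c : ℝ} (hc : 0 < c) : (∀ x, u x ≤ c) ↔ ∀ x, c⁻¹ ≤ l x := by
  constructor
  · intro hu x
    by_contra hx
    push Not at hx
    have h0 := hl.2.2 x
    have h1 := (hlu (Ac.scale (l x) h0 (unit K))).1 fun y => by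
      rw [h.map_const hunit h0, Ac.scale_apply, unit_apply, mul_one]
      exact (hu y).trans_lt ((lt_inv_comm₀ h0 hc).1 hx)
    simpa using h1 x
  · intro hl' x
    by_contra hx
    push Not at hx
    have h0 := hc.trans hx
    have h1 := (hlu (Ac.scale (u x)⁻¹ (inv_pos.2 h0) (unit K))).2 fun y => by
      rw [Ac.scale_apply, unit_apply, mul_one]
      exact (inv_strictAnti₀ hc hx).trans_le (hl' y)
    have h2 := h1 x
    rw [h.map_const hunit (inv_pos.2 h0)] at h2
    simp at h2

section Duality

variable [IsTopologicalAddGroup E] [ContinuousSMul ℝ E] [LocallyConvexSpace ℝ E] [T2Space E]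

/-- `u` is the infimum of the images of `Below l`. One implication is the Dini argument; the other
uses the room to scale a function strictly below `l`. -/
theorem exists_isDualPair_of_AlscPos (hK : IsCompact K) (hconv : Convex ℝ K) (hne : K.Nonempty)
    {Ψ : Ac K ≃ Ac K} (h : ScaleAntitone Ψ) {l : K → ℝ} (hl : l ∈ AlscPos K) :
    ∃ u ∈ Ausc K, IsDualPair Ψ l u := by
  have hdir := h.symm.directedOn_preimage_ge (directedOn_Below hK hconv hne hl)
  have hD : {g | Ψ.symm g ∈ Below l}.Nonempty := by
    obtain ⟨f, hf⟩ := Below_nonempty hK hne hl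
    exact ⟨Ψ f, by simpa using hf⟩
  obtain ⟨u, hu, hle, hlt⟩ := exists_inf_mem_Ausc hD hdir
  refine ⟨u, hu, fun f => ⟨fun hf => ?_, fun hf x => ?_⟩⟩
  · obtain ⟨g, hg, hgf⟩ := exists_mem_forall_gt_of_directed hK hD hdir
      (Ψ f).2.1.lowerSemicontinuous fun x => hlt x _ (hf x)
    have h1 := h.symm.le_iff.2 (show g ≤ Ψ f from fun x => (hgf x).le)
    rw [Equiv.symm_apply_apply] at h1
    exact isLowerSet_Below l h1 hg
  · obtain ⟨r, hr, hrf⟩ := exists_scale_mem_Below hK hconv hne hl hf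
    have h1 := hle (Ψ (Ac.scale r (one_pos.trans hr) f)) (by simpa using hrf) x
    rw [h.map_scale, Ac.scale_apply] at h1
    exact h1.trans_lt (mul_lt_of_lt_one_left ((Ψ f).2.2.2 x) (inv_lt_one_of_one_lt₀ hr))

/-- The lower bound `ε` on `u` bounds the preimages of `Above u` from above, which keeps their
supremum `l` finite. -/
theorem exists_isDualPair_of_Ausc (hK : IsCompact K) (hconv : Convex ℝ K) (hne : K.Nonempty)
    {Ψ : Ac K ≃ Ac K} (h : ScaleAntitone Ψ) {u : K → ℝ} (hu : u ∈ Ausc K) {ε : ℝ} (hε : 0 < ε)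
    (hεu : ∀ x, ε ≤ u x) : ∃ l ∈ AlscPos K, IsDualPair Ψ l u := by
  have hdir := h.directedOn_preimage_le (directedOn_Above hK hconv hne hu)
  have hD : {f | Ψ f ∈ Above u}.Nonempty := by
    obtain ⟨g, hg⟩ := Above_nonempty hK hne hu
    exact ⟨Ψ.symm g, by simpa using hg⟩
  obtain ⟨C, -, hC⟩ := Ac.exists_le_const hK (Ψ.symm (Ac.scale ε hε (unit K)))
  obtain ⟨l, hl, hle, hlt⟩ := exists_sup_mem_AlscPos hD hdir (C := C) (by
    intro f hf x
    have h1 := h.symm.le_iff.2 (show Ac.scale ε hε (unit K) ≤ Ψ f from fun y => by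
      have := (hεu y).trans (hf y).le
      simpa using this)
    rw [Equiv.symm_apply_apply] at h1
    exact (h1 x).trans (hC x))
  refine ⟨l, hl, fun f => ⟨fun hf x => ?_, fun hf => ?_⟩⟩
  · obtain ⟨g, hg, hgf⟩ := exists_lt_mem_Above hK hconv hne hu hf
    obtain ⟨r, hr, hrg⟩ := Ac.exists_scale_le hK hgf
    have h1 := (h f (Ψ.symm g) r (one_pos.trans hr)).1 (by simpa using hrg)
    have h2 := hle (Ψ.symm g) (by simpa using hg) x
    have h3 := lt_mul_of_one_lt_left (f.2.2.2 x) hr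
    exact h3.trans_le ((h1 x).trans h2)
  · obtain ⟨g, hg, hgf⟩ := exists_mem_forall_lt_of_directed hK hD hdir
      f.2.1.upperSemicontinuous fun x => hlt x _ (hf x)
    exact isUpperSet_Above u (h.le_iff.2 (show f ≤ g from fun x => (hgf x).le)) hg

variable {Ψ : Ac K ≃ Ac K} {l l' u u' : K → ℝ}

theorem IsDualPair.lsc_le (hK : IsCompact K) (hconv : Convex ℝ K) (hne : K.Nonempty)
    (hl : l ∈ AlscPos K) (hlu : IsDualPair Ψ l u) (hlu' : IsDualPair Ψ l' u')
    (h : ∀ x, u' x ≤ u x) : ∀ x, l x ≤ l' x :=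
  le_of_Below_subset hK hconv hne hl fun f hf =>
    (hlu' f).1 fun x => (h x).trans_lt ((hlu f).2 hf x)

theorem IsDualPair.usc_le (hK : IsCompact K) (hconv : Convex ℝ K)
    (hu : u ∈ Ausc K) (hlu : IsDualPair Ψ l u) (hlu' : IsDualPair Ψ l' u')
    (h : ∀ x, l x ≤ l' x) : ∀ x, u' x ≤ u x :=
  le_of_Above_subset hK hconv hu fun g hg x => by
    obtain ⟨f, rfl⟩ := Ψ.surjective g
    exact (hlu' f).2 (fun x => ((hlu f).1 hg x).trans_le (h x)) x

end Duality

/-! ### The images of the co-extremal functions -/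

/-- The image of the co-extremal function at `ψ`. -/
noncomputable def pureImage (Φ : Ac K ≃ Ac K) (ψ : K) : K → ℝ :=
  lscExtension Φ (coIndicator ψ)

theorem forall_le_coIndicator_iff {f : Ac K} {ψ : K} :
    (∀ y, (f.1 y : EReal) ≤ coIndicator ψ y) ↔ f.1 ψ ≤ 1 := by
  constructor
  · intro h
    have := h ψ
    simp only [coIndicator, if_true] at this
    exact_mod_cast this
  · intro h y
    by_cases hy : y = ψ
    · subst hy
      simp only [coIndicator, if_true]
      exact_mod_cast h
    · simp [coIndicator, hy]

theorem pureImage_le {Φ : Ac K ≃ Ac K} {ψ : K} {f : Ac K} (hf : f.1 ψ ≤ 1) (x : K) :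
    pureImage Φ ψ x ≤ (Φ f).1 x :=
  ciInf_le (f := fun f : {f : Ac K // ∀ y, (f.1 y : EReal) ≤ coIndicator ψ y} => (Φ f.1).1 x)
    ⟨0, by rintro _ ⟨g, rfl⟩; exact ((Φ g.1).2.2.2 x).le⟩ ⟨f, forall_le_coIndicator_iff.2 hf⟩

theorem le_pureImage {Φ : Ac K ≃ Ac K} {ψ x : K} {c : ℝ}
    (h : ∀ f : Ac K, f.1 ψ ≤ 1 → c ≤ (Φ f).1 x) : c ≤ pureImage Φ ψ x := by
  have : Nonempty {f : Ac K // ∀ y, (f.1 y : EReal) ≤ coIndicator ψ y} :=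
    ⟨⟨unit K, forall_le_coIndicator_iff.2 le_rfl⟩⟩
  exact le_ciInf fun f => h f.1 (forall_le_coIndicator_iff.1 f.2)

section PureImage

theorem exists_Ac_lt_at (ψ : K) {t : ℝ} (ht : 0 < t) : ∃ f : Ac K, f.1 ψ < t :=
  ⟨Ac.scale (t / 2) (half_pos ht) (unit K), by simp; linarith⟩

theorem smul_mem_Ausc {p : K → ℝ} (hp : p ∈ Ausc K) {t : ℝ} (ht : 0 ≤ t) :
    t • p ∈ Ausc K := by
  refine ⟨?_, ?_, fun x => mul_nonneg ht (hp.2.2 x)⟩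
  · rcases ht.eq_or_lt with rfl | ht
    · rw [zero_smul]
      exact upperSemicontinuous_const
    · intro x r hr
      have h1 : p x < r / t := by
        rw [lt_div_iff₀ ht, mul_comm]
        exact hr
      filter_upwards [hp.1 x _ h1] with y hy
      rw [lt_div_iff₀ ht, mul_comm] at hy
      exact hy
  · have := hp.2.1.mul_add t 0
    simp only [add_zero] at this
    exact this

variable {Φ : Ac K ≃ Ac K}

theorem pureImage_le_mul (h : ScaleAntitone Φ) {ψ : K} {f : Ac K} {c : ℝ} (hc : 0 < c)
    (hf : f.1 ψ ≤ c) (x : K) : pureImage Φ ψ x ≤ c * (Φ f).1 x := by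
  have h1 := pureImage_le (Φ := Φ) (f := Ac.scale c⁻¹ (inv_pos.2 hc) f) (ψ := ψ) (by
    rw [Ac.scale_apply, inv_mul_le_iff₀ hc, mul_one]
    exact hf) x
  rwa [h.map_scale, Ac.scale_apply, inv_inv] at h1

theorem exists_lt_of_pureImage_lt (h : ScaleAntitone Φ) {ψ x : K} {r : ℝ}
    (hr : pureImage Φ ψ x < r) : ∃ f : Ac K, f.1 ψ < 1 ∧ (Φ f).1 x < r := by
  by_contra hcon
  push Not at hcon
  refine hr.not_ge (le_pureImage fun f hf => le_of_forall_gt_imp_ge_of_dense fun c hc => ?_)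
  have hr' : 0 < r ∨ r ≤ 0 := lt_or_ge 0 r
  rcases hr' with hr' | hr'
  -- Scaling `f` by `Φ f x / c < 1` makes its value at `ψ` strictly less than `1` and the value of
  -- its image at `x` equal to `c`.
  · have hfx := (Φ f).2.2.2 x
    have hcpos := hfx.trans hc
    have hq : 0 < (Φ f).1 x / c := div_pos hfx hcpos
    have h1 := hcon (Ac.scale ((Φ f).1 x / c) hq f) (by
      rw [Ac.scale_apply]
      have : (Φ f).1 x / c < 1 := (div_lt_one hcpos).2 hc
      calc (Φ f).1 x / c * f.1 ψ ≤ (Φ f).1 x / c * 1 := mul_le_mul_of_nonneg_left hf hq.le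
        _ < 1 := by rwa [mul_one])
    rw [h.map_scale, Ac.scale_apply, inv_div, div_mul_cancel₀ _ hfx.ne'] at h1
    exact h1
  · exact hr'.trans ((Φ f).2.2.2 x |>.trans hc).le

/-- By homogeneity `pureImage Φ ψ χ` is the infimum of `f ψ * Φ f χ`, an expression symmetric in `Φ`
and its inverse. -/
theorem pureImage_symm_le (h : ScaleAntitone Φ) (ψ χ : K) :
    pureImage Φ ψ χ ≤ pureImage Φ.symm χ ψ := by
  refine le_pureImage fun g hg => ?_
  have hpos := (Φ.symm g).2.2.2 ψ
  have h1 := pureImage_le_mul h hpos le_rfl χ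
  rw [Equiv.apply_symm_apply] at h1
  exact h1.trans (mul_le_of_le_one_right hpos.le hg)

theorem pureImage_symm (h : ScaleAntitone Φ) (ψ χ : K) :
    pureImage Φ.symm χ ψ = pureImage Φ ψ χ :=
  le_antisymm (pureImage_symm_le h.symm χ ψ) (pureImage_symm_le h ψ χ)

theorem pureImage_le_one (hunit : Φ (unit K) = unit K) (ψ x : K) : pureImage Φ ψ x ≤ 1 := by
  have := pureImage_le (Φ := Φ) (f := unit K) (ψ := ψ) le_rfl x
  rwa [hunit] at this

variable [IsTopologicalAddGroup E] [ContinuousSMul ℝ E] [LocallyConvexSpace ℝ E] [T2Space E]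

theorem directedOn_lt_at_extBd (hK : IsCompact K) (hconv : Convex ℝ K) {ψ : K}
    (hψ : ψ ∈ extBd K) (t : ℝ) : DirectedOn (· ≤ ·) {f : Ac K | f.1 ψ < t} := by
  intro f hf g hg
  obtain ⟨k, h1, h2, h3⟩ := exists_Ac_above_at_extBd hK hconv hψ hf hg
  exact ⟨k, h3, h1, h2⟩

/-- This is the analogue of `IsDualPair` for the co-extremal function, which is not real-valued.
Extremality of `ψ` makes `{f | f ψ < 1}` directed, as the Dini argument requires. -/
theorem mem_Above_pureImage_iff (hK : IsCompact K) (hconv : Convex ℝ K)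
    (h : ScaleAntitone Φ) {ψ : K} (hψ : ψ ∈ extBd K) {f : Ac K} :
    Φ f ∈ Above (pureImage Φ ψ) ↔ f.1 ψ < 1 := by
  constructor
  · intro hf
    obtain ⟨f₁, hf₁⟩ := exists_Ac_lt_at ψ one_pos
    obtain ⟨g, hg, hgf⟩ := exists_mem_forall_gt_of_directed hK
      (D := {g | Φ.symm g ∈ {f : Ac K | f.1 ψ < 1}}) ⟨Φ f₁, by simpa using hf₁⟩
      (h.symm.directedOn_preimage_ge (directedOn_lt_at_extBd hK hconv hψ 1))
      (Φ f).2.1.lowerSemicontinuous (fun x => by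
        obtain ⟨k, hk, hkx⟩ := exists_lt_of_pureImage_lt h (hf x)
        exact ⟨Φ k, by simpa using hk, hkx⟩)
    have h1 := h.symm.le_iff.2 (show g ≤ Φ f from fun x => (hgf x).le)
    rw [Equiv.symm_apply_apply] at h1
    exact (h1 ψ).trans_lt hg
  · intro hf x
    exact (pureImage_le_mul h (f.2.2.2 ψ) le_rfl x).trans_lt
      (mul_lt_of_lt_one_left ((Φ f).2.2.2 x) hf)

theorem pureImage_mem_Ausc (hK : IsCompact K) (hconv : Convex ℝ K)
    (h : ScaleAntitone Φ) {ψ : K} (hψ : ψ ∈ extBd K) : pureImage Φ ψ ∈ Ausc K := by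
  obtain ⟨f₁, hf₁⟩ := exists_Ac_lt_at ψ one_pos
  obtain ⟨u, hu, hle, hlt⟩ := exists_inf_mem_Ausc
    (D := {g | Φ.symm g ∈ {f : Ac K | f.1 ψ < 1}}) ⟨Φ f₁, by simpa using hf₁⟩
    (h.symm.directedOn_preimage_ge (directedOn_lt_at_extBd hK hconv hψ 1))
  convert hu using 1
  funext x
  apply le_antisymm
  · refine le_of_forall_gt fun r hr => ?_
    obtain ⟨g, hg, hgx⟩ := hlt x r hr
    have h1 := pureImage_le (Φ := Φ) (le_of_lt hg) x
    rw [Equiv.apply_symm_apply] at h1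
    exact h1.trans_lt hgx
  · refine le_of_forall_gt fun r hr => ?_
    obtain ⟨f, hf, hfx⟩ := exists_lt_of_pureImage_lt h hr
    exact (hle (Φ f) (by simpa using hf) x).trans_lt hfx

/-- If a constant `s < 1` lay strictly above the image, its preimage, the constant `s⁻¹`, would be
less than `1` at `ψ`. -/
theorem one_le_of_pureImage_le (hK : IsCompact K) (hconv : Convex ℝ K)
    (h : ScaleAntitone Φ) (hunit : Φ (unit K) = unit K) {ψ : K} (hψ : ψ ∈ extBd K) {r : ℝ}
    (hr : ∀ x, pureImage Φ ψ x ≤ r) : 1 ≤ r := by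
  by_contra hr1
  push Not at hr1
  obtain ⟨s, hs, hs1⟩ := exists_between (max_lt hr1 one_pos)
  have hs0 : 0 < s := (le_max_right _ _).trans_lt hs
  have h1 := (mem_Above_pureImage_iff hK hconv h hψ
    (f := Ac.scale s⁻¹ (inv_pos.2 hs0) (unit K))).1 fun x => by
      rw [h.map_const hunit, Ac.scale_apply, unit_apply, mul_one, inv_inv]
      exact (hr x).trans_lt ((le_max_left _ _).trans_lt hs)
  rw [Ac.scale_apply, unit_apply, mul_one] at h1
  exact h1.not_gt ((one_lt_inv₀ hs0).2 hs1)

theorem exists_extBd_pureImage_eq_one (hK : IsCompact K) (hconv : Convex ℝ K)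
    (h : ScaleAntitone Φ) (hunit : Φ (unit K) = unit K) {ψ : K} (hψ : ψ ∈ extBd K) :
    ∃ χ ∈ extBd K, pureImage Φ ψ χ = 1 := by
  have hp := pureImage_mem_Ausc hK hconv h hψ
  obtain ⟨χ, hχ, hmax⟩ := exists_extBd_max hK ⟨ψ, ψ.2⟩ hp.1 hp.2.1
  exact ⟨χ, hχ, le_antisymm (pureImage_le_one hunit _ _)
    (one_le_of_pureImage_le hK hconv h hunit hψ hmax)⟩

/-- The `f` with `Φ f` strictly above `q` form a proper directed lower set containing `{f | f ψ <
1}`. It is therefore given by a bound `c` at `ψ`, and homogeneity turns this into the factor `c⁻¹`.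
-/
theorem eq_smul_pureImage_of_le (hK : IsCompact K) (hconv : Convex ℝ K)
    (h : ScaleAntitone Φ) {ψ : K} (hψ : ψ ∈ extBd K) {q : K → ℝ} (hq : q ∈ Ausc K)
    (hqp : q ≤ pureImage Φ ψ) {x₀ : K} (hx₀ : 0 < q x₀) :
    ∃ t ∈ Icc (0 : ℝ) 1, q = t • pureImage Φ ψ := by
  have hne : K.Nonempty := ⟨ψ, ψ.2⟩
  obtain ⟨c, hc, hcD, hDc⟩ := exists_bound_iff hK hconv hψ
    (D := {f | Φ f ∈ Above q})
    (fun f g hgf hf => isUpperSet_Above q (h.le_iff.2 hgf) hf)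
    (h.directedOn_preimage_le (directedOn_Above hK hconv hne hq))
    (f₀ := Φ.symm (Ac.scale (q x₀) hx₀ (unit K)))
    (by
      intro hmem
      have h1 : Ac.scale (q x₀) hx₀ (unit K) ∈ Above q := by simpa using hmem
      simpa using h1 x₀)
    one_pos
    (fun f hf x => (hqp x).trans_lt ((mem_Above_pureImage_iff hK hconv h hψ).2 hf x))
  have heq : q = c⁻¹ • pureImage Φ ψ := by
    funext x
    rw [Pi.smul_apply, smul_eq_mul]
    apply le_antisymm
    · rw [← div_eq_inv_mul, le_div_iff₀ hc, mul_comm]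
      refine le_of_forall_gt fun r hr => ?_
      obtain ⟨f, hf, hfx⟩ := exists_lt_of_pureImage_lt h hr
      have h1 := hcD (Ac.scale c hc f) (by
        rw [Ac.scale_apply]
        exact mul_lt_of_lt_one_right hc hf) x
      rw [h.map_scale, Ac.scale_apply, ← div_eq_inv_mul, lt_div_iff₀ hc, mul_comm] at h1
      exact h1.trans hfx
    · refine le_of_forall_gt fun r hr => ?_
      obtain ⟨g, hg, hgx⟩ := exists_mem_Above_lt hK hconv hq hr
      have h1 := pureImage_le_mul h hc (hDc (Φ.symm g) (by simpa using hg)) x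
      rw [Equiv.apply_symm_apply] at h1
      exact ((inv_mul_le_iff₀ hc).2 h1).trans_lt hgx
  refine ⟨c⁻¹, ⟨(inv_pos.2 hc).le, ?_⟩, heq⟩
  have h1 := hqp x₀
  have h2 : q x₀ = c⁻¹ * pureImage Φ ψ x₀ := congrFun heq x₀
  have h3 : 0 < pureImage Φ ψ x₀ := hx₀.trans_le h1
  rw [h2] at h1
  exact (mul_le_iff_le_one_left h3).1 h1

theorem isNormalizedExtremal_pureImage (hK : IsCompact K) (hconv : Convex ℝ K)
    (h : ScaleAntitone Φ) (hunit : Φ (unit K) = unit K) {ψ : K} (hψ : ψ ∈ extBd K) :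
    IsNormalizedExtremal (pureImage Φ ψ) := by
  have hp := pureImage_mem_Ausc hK hconv h hψ
  refine ⟨⟨hp, ?_⟩, ?_⟩
  · ext q
    constructor
    · rintro ⟨hq, hqp⟩
      by_cases h0 : ∃ x₀, 0 < q x₀
      · obtain ⟨x₀, hx₀⟩ := h0
        exact eq_smul_pureImage_of_le hK hconv h hψ hq hqp hx₀
      · push Not at h0
        refine ⟨0, ⟨le_rfl, zero_le_one⟩, ?_⟩
        funext x
        simpa using le_antisymm (h0 x) (hq.2.2 x)
    · rintro ⟨t, ht, rfl⟩
      exact ⟨smul_mem_Ausc hp ht.1, fun x => mul_le_of_le_one_left (hp.2.2 x) ht.2⟩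
  · have hmem : (1 : ℝ) ∈ {r : ℝ | 0 < r ∧ ∀ x, pureImage Φ ψ x ≤ r * (unit K).1 x} :=
      ⟨one_pos, fun x => by simpa using pureImage_le_one hunit ψ x⟩
    refine le_antisymm (csInf_le ⟨0, fun r hr => hr.1.le⟩ hmem) (le_csInf ⟨1, hmem⟩ ?_)
    rintro r ⟨-, hr⟩
    exact one_le_of_pureImage_le hK hconv h hunit hψ fun x => by simpa using hr x

theorem pureImage_injOn (hK : IsCompact K) (hconv : Convex ℝ K)
    (h : ScaleAntitone Φ) {ψ ψ' : K} (hψ : ψ ∈ extBd K) (hψ' : ψ' ∈ extBd K)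
    (heq : pureImage Φ ψ = pureImage Φ ψ') : ψ' = ψ :=
  extBd_eq_of_le hK hconv hψ (c := 1) fun f hf => by
    have h1 := (mem_Above_pureImage_iff hK hconv h hψ).2 hf
    rw [heq] at h1
    exact ((mem_Above_pureImage_iff hK hconv h hψ').1 h1).le

end PureImage

/-! ### Segments in extremal directions -/

theorem one_add_mem_Ausc {v : K → ℝ} (hv : v ∈ Ausc K) : (fun x => 1 + v x) ∈ Ausc K := by
  refine ⟨fun x r hr => ?_, ?_, fun x => by have := hv.2.2 x; positivity⟩
  · filter_upwards [hv.1 x (r - 1) (lt_sub_iff_add_lt'.2 hr)] with y hy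
    exact lt_sub_iff_add_lt'.1 hy
  · have := hv.2.1.mul_add 1 1
    simpa only [one_mul, add_comm] using this

theorem sub_one_mem_Ausc {u : K → ℝ} (hu : u ∈ Ausc K) (h : ∀ x, 1 ≤ u x) :
    (fun x => u x - 1) ∈ Ausc K := by
  refine ⟨fun x r hr => ?_, ?_, fun x => sub_nonneg.2 (h x)⟩
  · filter_upwards [hu.1 x (r + 1) (sub_lt_iff_lt_add.1 hr)] with y hy
    exact sub_lt_iff_lt_add.2 hy
  · have := hu.2.1.mul_add 1 (-1)
    simpa only [one_mul, ← sub_eq_add_neg] using this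

theorem one_sub_mem_AlscPos {v : K → ℝ} (hv : v ∈ Ausc K) (h : ∀ x, v x < 1) :
    (fun x => 1 - v x) ∈ AlscPos K := by
  refine ⟨fun x r hr => ?_, ?_, fun x => sub_pos.2 (h x)⟩
  · filter_upwards [hv.1 x (1 - r) (lt_sub_comm.1 hr)] with y hy
    exact lt_sub_comm.1 hy
  · have := hv.2.1.mul_add (-1) 1
    simpa only [neg_one_mul, neg_add_eq_sub] using this

theorem one_sub_mem_Ausc {l : K → ℝ} (hl : l ∈ AlscPos K) (h : ∀ x, l x ≤ 1) :
    (fun x => 1 - l x) ∈ Ausc K := by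
  refine ⟨fun x r hr => ?_, ?_, fun x => sub_nonneg.2 (h x)⟩
  · filter_upwards [hl.1 x (1 - r) (sub_lt_comm.1 hr)] with y hy
    exact sub_lt_comm.1 hy
  · have := hl.2.1.mul_add (-1) 1
    simpa only [neg_one_mul, neg_add_eq_sub] using this

/-- The segment from `1` in direction `-q`, parametrized such that the extension of a
gauge-reversing map sends it to an affinely parametrized ray. -/
noncomputable def extremalSegment (q : K → ℝ) (t : ℝ) : K → ℝ := fun x => 1 - t / (1 + t) * q x

section Segment

variable {Ψ : Ac K ≃ Ac K} {q : K → ℝ} {χ : K}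

theorem extremalSegment_mem_AlscPos (hq : q ∈ Ausc K) (hq1 : ∀ x, q x ≤ 1) {t : ℝ}
    (ht : 0 ≤ t) : extremalSegment q t ∈ AlscPos K := by
  have h0 : 0 ≤ t / (1 + t) := by positivity
  refine one_sub_mem_AlscPos (smul_mem_Ausc hq h0) fun x => ?_
  calc t / (1 + t) * q x ≤ t / (1 + t) * 1 := mul_le_mul_of_nonneg_left (hq1 x) h0
    _ < 1 := by rw [mul_one, div_lt_one (by positivity)]; linarith

theorem extremalSegment_apply_of_eq_one {E : Type*} {K : Set E} {q : K → ℝ} {χ : K}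
    (hχ : q χ = 1) {t : ℝ} (ht : 0 ≤ t) : extremalSegment q t χ = (1 + t)⁻¹ := by
  have : (1 + t) ≠ 0 := by positivity
  simp only [extremalSegment, hχ]
  field_simp
  ring

/-- The segment function has minimum `(1 + t)⁻¹`, attained at `χ`; so the maximum of `v` recovers
the parameter `t`. -/
theorem IsDualPair.segment_forall_le_iff (h : ScaleAntitone Ψ) (hunit : Ψ (unit K) = unit K)
    (hq : q ∈ Ausc K) (hq1 : ∀ x, q x ≤ 1) (hχ : q χ = 1) {t : ℝ} (ht : 0 ≤ t) {v : K → ℝ}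
    (hv : IsDualPair Ψ (extremalSegment q t) fun x => 1 + v x) {c : ℝ} (hc : 0 ≤ c) :
    (∀ x, v x ≤ c) ↔ t ≤ c := by
  have hc' : 0 < 1 + c := by positivity
  have ht' : 0 < 1 + t := by positivity
  have h1 := hv.forall_le_iff h hunit (extremalSegment_mem_AlscPos hq hq1 ht) hc'
  simp only [add_le_add_iff_left] at h1
  rw [h1]
  constructor
  · intro h2
    have h3 := h2 χ
    rw [extremalSegment_apply_of_eq_one hχ ht, inv_le_inv₀ hc' ht'] at h3
    linarith
  · intro h2 x
    have h3 : (1 + c)⁻¹ ≤ (1 + t)⁻¹ := (inv_le_inv₀ hc' ht').2 (by linarith)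
    rw [← extremalSegment_apply_of_eq_one hχ ht] at h3
    refine h3.trans (sub_le_sub_left (mul_le_mul_of_nonneg_left ?_ (by positivity)) 1)
    rw [hχ]
    exact hq1 x

variable [IsTopologicalAddGroup E] [ContinuousSMul ℝ E] [LocallyConvexSpace ℝ E] [T2Space E]

theorem exists_isDualPair_segment (hK : IsCompact K) (hconv : Convex ℝ K) (hne : K.Nonempty)
    (h : ScaleAntitone Ψ) (hunit : Ψ (unit K) = unit K) (hq : q ∈ Ausc K)
    (hq1 : ∀ x, q x ≤ 1) {t : ℝ} (ht : 0 ≤ t) :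
    ∃ v ∈ Ausc K, IsDualPair Ψ (extremalSegment q t) fun x => 1 + v x := by
  obtain ⟨u, hu, hd⟩ := exists_isDualPair_of_AlscPos hK hconv hne h
    (extremalSegment_mem_AlscPos hq hq1 ht)
  refine ⟨fun x => u x - 1, sub_one_mem_Ausc hu fun x => ?_, by simpa using hd⟩
  refine le_of_forall_gt fun r hr => ?_
  obtain ⟨g, hg, hgx⟩ := exists_mem_Above_lt hK hconv hu hr
  obtain ⟨f, rfl⟩ := Ψ.surjective g
  have h1 : f ≤ unit K := fun y => ((hd f).1 hg y).le.trans
    (sub_le_self 1 (mul_nonneg (by positivity) (hq.2.2 y)))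
  have h2 := h.le_iff.2 h1 x
  rw [hunit] at h2
  exact lt_of_le_of_lt h2 hgx

/-- The function `l` dual to `1 + v` lies between the segment function and `1`. Hence `1 - l` lies
below `q`, and extremality makes it a multiple of `q`. -/
theorem IsDualPair.exists_segment_of_le (hK : IsCompact K) (hconv : Convex ℝ K)
    (hne : K.Nonempty) (h : ScaleAntitone Ψ) (hunit : Ψ (unit K) = unit K)
    (hq : IsExtremalVector q) (hq1 : ∀ x, q x ≤ 1) (hχ : q χ = 1) {t : ℝ} (ht : 0 ≤ t)
    {w : K → ℝ} (hw : IsDualPair Ψ (extremalSegment q t) fun x => 1 + w x)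
    {v : K → ℝ} (hv : v ∈ Ausc K) (hvw : ∀ x, v x ≤ w x) :
    ∃ s, 0 ≤ s ∧ s ≤ t ∧ IsDualPair Ψ (extremalSegment q s) fun x => 1 + v x := by
  obtain ⟨l, hl, hd⟩ := exists_isDualPair_of_Ausc hK hconv hne h (one_add_mem_Ausc hv) one_pos
    fun x => le_add_of_nonneg_right (hv.2.2 x)
  have hle := hw.lsc_le hK hconv hne (extremalSegment_mem_AlscPos hq.1 hq1 ht) hd
    fun x => by linarith [hvw x]
  have hl1 : ∀ x, l x ≤ 1 := fun x => by
    refine le_of_forall_lt fun r hr => ?_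
    obtain ⟨f, hf, hfx⟩ := exists_mem_Below_gt hK hconv hne hl hr
    have h1 : unit K ≤ Ψ f := fun y =>
      (le_add_of_nonneg_right (hv.2.2 y)).trans ((hd f).2 hf y).le
    rw [← hunit] at h1
    exact hfx.trans_le (h.le_iff.1 h1 x)
  have hr1 : t / (1 + t) < 1 := by rw [div_lt_one (by positivity)]; linarith
  have hmem : (fun x => 1 - l x) ∈ {f | f ∈ Ausc K ∧ f ≤ q} := by
    refine ⟨one_sub_mem_Ausc hl hl1, fun x => ?_⟩
    have h1 : 1 - t / (1 + t) * q x ≤ l x := hle x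
    have h2 := mul_le_of_le_one_left (hq.1.2.2 x) hr1.le
    show 1 - l x ≤ q x
    linarith
  rw [hq.2] at hmem
  obtain ⟨r, ⟨hr0, -⟩, hr⟩ := hmem
  have hlr : ∀ x, l x = 1 - r * q x := fun x => by
    have := congrFun hr x
    simp only [Pi.smul_apply, smul_eq_mul] at this
    linarith
  have hrt : r ≤ t / (1 + t) := by
    have h1 : 1 - t / (1 + t) * q χ ≤ l χ := hle χ
    rw [hlr, hχ] at h1
    linarith
  have hr1' : 0 < 1 - r := by linarith
  -- This inverts the parametrization `r = s / (1 + s)`.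
  refine ⟨r / (1 - r), by positivity, ?_, ?_⟩
  · rw [div_le_iff₀ hr1']
    rw [le_div_iff₀ (by positivity)] at hrt
    linarith
  · convert hd using 1
    funext x
    have : r / (1 - r) / (1 + r / (1 - r)) = r := by
      field_simp
      ring
    rw [hlr, extremalSegment, this]

/-- The multiple `a • v` belongs to some parameter `s`; comparing upper bounds forces `s = a * t`.
-/
theorem IsDualPair.segment_smul (hK : IsCompact K) (hconv : Convex ℝ K)
    (hne : K.Nonempty) (h : ScaleAntitone Ψ) (hunit : Ψ (unit K) = unit K)
    (hq : IsExtremalVector q) (hq1 : ∀ x, q x ≤ 1) (hχ : q χ = 1) {t : ℝ} (ht : 0 ≤ t)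
    {v : K → ℝ} (hv : v ∈ Ausc K) (hd : IsDualPair Ψ (extremalSegment q t) fun x => 1 + v x)
    {a : ℝ} (ha : 0 < a) (ha1 : a ≤ 1) :
    IsDualPair Ψ (extremalSegment q (a * t)) fun x => 1 + a * v x := by
  obtain ⟨s, hs, -, hsd⟩ := hd.exists_segment_of_le hK hconv hne h hunit hq hq1 hχ ht
    (smul_mem_Ausc hv ha.le) fun x => mul_le_of_le_one_left (hv.2.2 x) ha1
  have hat : 0 ≤ a * t := by positivity
  have h1 : s ≤ a * t := (hsd.segment_forall_le_iff h hunit hq.1 hq1 hχ hs hat).1 fun x =>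
    mul_le_mul_of_nonneg_left
      ((hd.segment_forall_le_iff h hunit hq.1 hq1 hχ ht ht).2 le_rfl x) ha.le
  have h2 : t ≤ s / a := (hd.segment_forall_le_iff h hunit hq.1 hq1 hχ ht (by positivity)).1
    fun x => by
      rw [le_div_iff₀ ha, mul_comm]
      exact (hsd.segment_forall_le_iff h hunit hq.1 hq1 hχ hs hs).2 le_rfl x
  rw [le_div_iff₀ ha, mul_comm] at h2
  rw [le_antisymm h2 h1]
  exact hsd

/-- The image of the segment from `1` in an extremal direction `-q` with `q χ = 1 = max q` is
the ray from `1` in the direction of the image of the co-extremal function at `χ`. -/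
theorem isDualPair_segment_pureImage (hK : IsCompact K) (hconv : Convex ℝ K)
    (h : ScaleAntitone Ψ) (hunit : Ψ (unit K) = unit K)
    (hq : IsExtremalVector q) (hq1 : ∀ x, q x ≤ 1) (hχe : χ ∈ extBd K) (hχ : q χ = 1) :
    IsDualPair Ψ (extremalSegment q 1) fun x => 1 + pureImage Ψ χ x := by
  have hne : K.Nonempty := ⟨χ, χ.2⟩
  obtain ⟨v, hv, hd⟩ := exists_isDualPair_segment hK hconv hne h hunit hq.1 hq1 zero_le_one
  -- Shrinking the image at parameter `t` by `t⁻¹` gives the image at parameter `1`, so the images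
  -- form a ray.
  have hray : ∀ t, 1 ≤ t → IsDualPair Ψ (extremalSegment q t) fun x => 1 + t * v x := by
    intro t ht
    have ht0 : 0 < t := one_pos.trans_le ht
    obtain ⟨w, hw, hwd⟩ := exists_isDualPair_segment hK hconv hne h hunit hq.1 hq1 ht0.le
    have h1 := hwd.segment_smul hK hconv hne h hunit hq hq1 hχ ht0.le hw (inv_pos.2 ht0)
      (inv_le_one_of_one_le₀ ht)
    rw [inv_mul_cancel₀ ht0.ne'] at h1
    have hw' := one_add_mem_Ausc (smul_mem_Ausc hw (inv_pos.2 ht0).le)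
    have h2 := hd.usc_le hK hconv (one_add_mem_Ausc hv) h1 fun x => le_rfl
    have h3 : ∀ x, 1 + v x ≤ 1 + t⁻¹ * w x := h1.usc_le hK hconv hw' hd fun x => le_rfl
    convert hwd using 3 with x
    have h4 : v x = t⁻¹ * w x := by linarith [h2 x, h3 x]
    rw [h4, mul_inv_cancel_left₀ ht0.ne']
  set p := pureImage Ψ χ
  have hpv : ∀ x, p x ≤ v x := by
    intro x
    -- A function below the segment function is less than `(1 + t)⁻¹` at `χ`, so its image dominates
    -- `(1 + t) * p`. Large `t` then yields `p ≤ v`.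
    have hkey : ∀ t, 1 ≤ t → (1 + t) * p x ≤ 1 + t * v x := by
      intro t ht
      have ht0 : 0 < t := one_pos.trans_le ht
      refine le_of_forall_gt fun r hr => ?_
      obtain ⟨g, hg, hgx⟩ := exists_mem_Above_lt hK hconv
        (one_add_mem_Ausc (smul_mem_Ausc hv ht0.le)) hr
      obtain ⟨f, rfl⟩ := Ψ.surjective g
      have h1 := (hray t ht f).1 hg χ
      rw [extremalSegment_apply_of_eq_one hχ ht0.le] at h1
      have h2 := pureImage_le_mul h (inv_pos.2 (by positivity : 0 < 1 + t)) h1.le x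
      rw [le_inv_mul_iff₀ (by positivity)] at h2
      exact h2.trans_lt hgx
    by_contra hcon
    push Not at hcon
    have hδ : 0 < p x - v x := sub_pos.2 hcon
    have hp0 : 0 ≤ p x := (pureImage_mem_Ausc hK hconv h hχe).2.2 x
    -- With `δ = p x - v x`, `hkey` reads `p x + t * δ ≤ 1`, which fails for `t = 1 + δ⁻¹`.
    have h1 := hkey (1 + (p x - v x)⁻¹) (le_add_of_nonneg_right (inv_pos.2 hδ).le)
    have h2 : (p x - v x)⁻¹ * (p x - v x) = 1 := inv_mul_cancel₀ hδ.ne'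
    nlinarith
  -- Being below `v`, `p` has a parameter `s ≤ 1`; since no bound of `p` is less than `1`, `s = 1`.
  obtain ⟨s, hs, hs1, hsd⟩ := hd.exists_segment_of_le hK hconv hne h hunit hq hq1 hχ zero_le_one
    (pureImage_mem_Ausc hK hconv h hχe) hpv
  have h1 : 1 ≤ s := one_le_of_pureImage_le hK hconv h hunit hχe
    ((hsd.segment_forall_le_iff h hunit hq.1 hq1 hχ hs hs).2 le_rfl)
  rwa [le_antisymm hs1 h1] at hsd

theorem IsExtremalVector.eq_of_eq_one (hK : IsCompact K) (hconv : Convex ℝ K)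
    (h : ScaleAntitone Ψ) (hunit : Ψ (unit K) = unit K) (hχe : χ ∈ extBd K) {q' : K → ℝ}
    (hq : IsExtremalVector q) (hq1 : ∀ x, q x ≤ 1) (hχ : q χ = 1)
    (hq' : IsExtremalVector q') (hq1' : ∀ x, q' x ≤ 1) (hχ' : q' χ = 1) : q = q' := by
  have hne : K.Nonempty := ⟨χ, χ.2⟩
  have hd := isDualPair_segment_pureImage hK hconv h hunit hq hq1 hχe hχ
  have hd' := isDualPair_segment_pureImage hK hconv h hunit hq' hq1' hχe hχ'
  funext x
  have h1 := hd.lsc_le hK hconv hne (extremalSegment_mem_AlscPos hq.1 hq1 zero_le_one) hd'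
    (fun x => le_rfl) x
  have h2 := hd'.lsc_le hK hconv hne (extremalSegment_mem_AlscPos hq'.1 hq1' zero_le_one) hd
    (fun x => le_rfl) x
  simp only [extremalSegment] at h1 h2
  linarith

theorem eq_of_pureImage_eq_one (hK : IsCompact K) (hconv : Convex ℝ K)
    (h : ScaleAntitone Ψ) (hunit : Ψ (unit K) = unit K) (hχe : χ ∈ extBd K) {ψ ψ' : K}
    (hψ : ψ ∈ extBd K) (hψ' : ψ' ∈ extBd K) (h1 : pureImage Ψ ψ χ = 1)
    (h2 : pureImage Ψ ψ' χ = 1) : ψ' = ψ :=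
  pureImage_injOn hK hconv h hψ hψ' (IsExtremalVector.eq_of_eq_one hK hconv h hunit hχe
    (isNormalizedExtremal_pureImage hK hconv h hunit hψ).1 (pureImage_le_one hunit ψ) h1
    (isNormalizedExtremal_pureImage hK hconv h hunit hψ').1 (pureImage_le_one hunit ψ') h2)

end Segment

/-! ### Gauge-preserving maps -/

section Preserving

variable [IsTopologicalAddGroup E] [ContinuousSMul ℝ E] [LocallyConvexSpace ℝ E] [T2Space E]

/-- The image of `{f | f ψ < 1}` is bounded at some extreme `χ`. Pulling back `{g | g χ < k}` for
large `k` gives a set described by a bound `d` at `ψ`; homogeneity yields `d * Φ f χ = k * f ψ`, and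
the unit gives `d = k`. -/
theorem ScaleMonotone.exists_apply_eq (hK : IsCompact K) (hconv : Convex ℝ K)
    {Φ : Ac K ≃ Ac K} (h : ScaleMonotone Φ) (hunit : Φ (unit K) = unit K) {ψ : K}
    (hψ : ψ ∈ extBd K) : ∃ χ ∈ extBd K, ∀ f : Ac K, (Φ f).1 χ = f.1 ψ := by
  obtain ⟨f₁, hf₁⟩ := exists_Ac_lt_at ψ one_pos
  obtain ⟨χ, hχ, c, hc, hbd⟩ := exists_extBd_bound hK
    (D := {g | Φ.symm g ∈ {f : Ac K | f.1 ψ < 1}}) ⟨Φ f₁, by simpa using hf₁⟩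
    (fun f g hgf hf => lt_of_le_of_lt (h.symm.le_iff.2 hgf ψ) hf)
    (h.symm.directedOn_preimage (directedOn_lt_at_extBd hK hconv hψ 1))
    (f₀ := Φ (unit K)) (by simp)
  obtain ⟨k, hk, hck⟩ : ∃ k > 0, c < k := ⟨c + 1, by linarith, by linarith⟩
  obtain ⟨d, hd, h1, h2⟩ := exists_bound_iff hK hconv hψ
    (D := {f | Φ f ∈ {g : Ac K | g.1 χ < k}})
    (fun f g hgf hf => lt_of_le_of_lt (h.le_iff.2 hgf χ) hf)
    (h.directedOn_preimage (directedOn_lt_at_extBd hK hconv hχ k))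
    (f₀ := Φ.symm (Ac.scale k hk (unit K))) (by simp) one_pos
    (fun f hf => (hbd (Φ f) (by simpa using hf)).trans_lt hck)
  have hle : ∀ f : Ac K, d * (Φ f).1 χ ≤ k * f.1 ψ := by
    intro f
    by_contra hcon
    push Not at hcon
    have hpos := (Φ f).2.2.2 χ
    have h3 : (Φ (Ac.scale (k / (Φ f).1 χ) (div_pos hk hpos) f)).1 χ < k := h1 _ (by
      rw [Ac.scale_apply, div_mul_eq_mul_div, div_lt_iff₀ hpos]
      exact hcon)
    rw [h.map_scale, Ac.scale_apply, div_mul_cancel₀ _ hpos.ne'] at h3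
    exact lt_irrefl _ h3
  have hge : ∀ f : Ac K, k * f.1 ψ ≤ d * (Φ f).1 χ := by
    intro f
    by_contra hcon
    push Not at hcon
    have hpos := (Φ f).2.2.2 χ
    have hpos' := f.2.2.2 ψ
    obtain ⟨r, hr1, hr2⟩ := exists_between ((div_lt_div_iff₀ hpos' hpos).2 hcon)
    have hr : 0 < r := (div_pos hd hpos').trans hr1
    have h3 := h2 (Ac.scale r hr f) (by
      show (Φ (Ac.scale r hr f)).1 χ < k
      rw [h.map_scale, Ac.scale_apply]
      exact (lt_div_iff₀ hpos).1 hr2)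
    rw [Ac.scale_apply] at h3
    exact h3.not_gt ((div_lt_iff₀ hpos').1 hr1)
  have hdk : d = k := by
    have h3 := hle (unit K)
    have h4 := hge (unit K)
    simp only [hunit, unit_apply, mul_one] at h3 h4
    exact le_antisymm h3 h4
  subst hdk
  exact ⟨χ, hχ, fun f => mul_left_cancel₀ hk.ne' (le_antisymm (hle f) (hge f))⟩

theorem eq_of_forall_apply_eq (hK : IsCompact K) (hconv : Convex ℝ K) {ψ χ : K}
    (hψ : ψ ∈ extBd K) (h : ∀ f : Ac K, f.1 χ = f.1 ψ) : χ = ψ :=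
  extBd_eq_of_le hK hconv hψ (c := 1) fun f hf => (h f).trans_le hf.le

end Preserving

/-! ### Boundary bijections -/

theorem exists_equiv_of_relation {A B : Type*} {R : A → B → Prop} (h₁ : ∀ a, ∃ b, R a b)
    (h₂ : ∀ b, ∃ a, R a b) (u₁ : ∀ a b b', R a b → R a b' → b = b')
    (u₂ : ∀ a a' b, R a b → R a' b → a = a') : ∃ e : A ≃ B, ∀ a, R a (e a) := by
  choose F hF using h₁
  choose G hG using h₂
  exact ⟨⟨F, G, fun a => u₂ _ _ _ (hG _) (hF _), fun b => u₁ _ _ _ (hF _) (hG _)⟩, hF⟩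

/-- The transition function of `Φ` is invariant under the boundary map induced by `Φ ∘ Φ`. -/
theorem pureImage_comp_self {Φ : Ac K ≃ Ac K} (h : ScaleAntitone Φ) {ψ χ χ' : K}
    (hχ : ∀ f : Ac K, (Φ (Φ f)).1 χ' = f.1 ψ) :
    pureImage Φ ψ χ ≤ pureImage Φ χ χ' := by
  refine le_pureImage fun g hg => ?_
  have hpos := (Φ.symm g).2.2.2 ψ
  have h1 := pureImage_le_mul h hpos le_rfl χ
  rw [Equiv.apply_symm_apply] at h1
  have h2 := hχ (Φ.symm g)
  rw [Equiv.apply_symm_apply] at h2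
  rw [h2]
  exact h1.trans (mul_le_of_le_one_right hpos.le hg)

/-- If `f ψ ≤ 1`, then `Φ f` at `α ψ` is `1 / f ψ ≥ 1`. This places the graph of `α` inside the
relation defining the induced bijection. -/
theorem ReciprocalOnBoundary.pureImage_eq_one {Φ : Ac K ≃ Ac K}
    (hunit : Φ (unit K) = unit K) {α : extBd K ≃ extBd K} (hα : ReciprocalOnBoundary Φ α)
    (ψ : extBd K) : pureImage Φ ψ (α ψ) = 1 := by
  refine le_antisymm (pureImage_le_one hunit _ _) (le_pureImage fun f hf => ?_)
  have h1 := hα.1 f (α ψ)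
  rw [Equiv.symm_apply_apply] at h1
  rw [h1]
  exact (one_le_div (f.2.2.2 _)).2 hf

section Main

variable [IsTopologicalAddGroup E] [ContinuousSMul ℝ E] [LocallyConvexSpace ℝ E] [T2Space E]

theorem ScaleMonotone.exists_equiv (hK : IsCompact K) (hconv : Convex ℝ K)
    {Φ : Ac K ≃ Ac K} (h : ScaleMonotone Φ) (hunit : Φ (unit K) = unit K) :
    ∃ α : extBd K ≃ extBd K, ∀ (f : Ac K) (ψ : extBd K), (Φ f).1 (α ψ) = f.1 ψ := by
  have hunit' : Φ.symm (unit K) = unit K := by rw [Equiv.symm_apply_eq, hunit]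
  obtain ⟨α, hα⟩ := exists_equiv_of_relation
    (R := fun ψ χ : extBd K => ∀ f : Ac K, (Φ f).1 χ = f.1 ψ)
    (fun ψ => by
      obtain ⟨χ, hχ, hf⟩ := h.exists_apply_eq hK hconv hunit ψ.2
      exact ⟨⟨χ, hχ⟩, hf⟩)
    (fun χ => by
      obtain ⟨ψ, hψ, hf⟩ := h.symm.exists_apply_eq hK hconv hunit' χ.2
      exact ⟨⟨ψ, hψ⟩, fun f => by rw [← hf, Equiv.symm_apply_apply]⟩)
    (fun ψ χ χ' h1 h2 => Subtype.ext (eq_of_forall_apply_eq hK hconv χ'.2 fun g => by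
      obtain ⟨f, rfl⟩ := Φ.surjective g
      rw [h1, h2]))
    (fun ψ ψ' χ h1 h2 => Subtype.ext (eq_of_forall_apply_eq hK hconv ψ'.2 fun f => by
      rw [← h1, h2]))
  exact ⟨α, fun f ψ => hα ψ f⟩

theorem involutive_iff_of_forall_apply_eq (hK : IsCompact K) (hconv : Convex ℝ K)
    {F : Ac K → Ac K} {β : extBd K ≃ extBd K}
    (hβ : ∀ (f : Ac K) (ψ : extBd K), (F f).1 (β ψ) = f.1 ψ) :
    (∀ f, F f = f) ↔ ∀ ψ, β ψ = ψ := by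
  constructor
  · intro hF ψ
    refine Subtype.ext (eq_of_forall_apply_eq hK hconv ψ.2 fun f => ?_)
    rw [← hβ f ψ, hF]
  · intro h f
    refine Ac.eq_of_eq_on_extBd hK fun ψ hψ => ?_
    have := hβ f ⟨ψ, hψ⟩
    rwa [h] at this

/-- Existence and uniqueness of `ψ` for given `χ`, and of `χ` for given `ψ`, are one statement
applied to `Φ` and to its inverse, linked by `pureImage_symm`. -/
theorem ScaleAntitone.exists_equiv (hK : IsCompact K) (hconv : Convex ℝ K)
    {Φ : Ac K ≃ Ac K} (h : ScaleAntitone Φ) (hunit : Φ (unit K) = unit K) :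
    ∃ α : extBd K ≃ extBd K, ∀ ψ χ : extBd K, pureImage Φ ψ χ = 1 ↔ χ = α ψ := by
  have hunit' : Φ.symm (unit K) = unit K := by rw [Equiv.symm_apply_eq, hunit]
  have huniq : ∀ ψ χ χ' : extBd K, pureImage Φ ψ χ = 1 → pureImage Φ ψ χ' = 1 → χ = χ' :=
    fun ψ χ χ' h1 h2 => Subtype.ext (eq_of_pureImage_eq_one hK hconv h.symm hunit' ψ.2 χ'.2 χ.2
      (by rw [pureImage_symm h, h2]) (by rw [pureImage_symm h, h1]))
  obtain ⟨α, hα⟩ := exists_equiv_of_relation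
    (R := fun ψ χ : extBd K => pureImage Φ ψ χ = 1)
    (fun ψ => by
      obtain ⟨χ, hχ, hf⟩ := exists_extBd_pureImage_eq_one hK hconv h hunit ψ.2
      exact ⟨⟨χ, hχ⟩, hf⟩)
    (fun χ => by
      obtain ⟨ψ, hψ, hf⟩ := exists_extBd_pureImage_eq_one hK hconv h.symm hunit' χ.2
      exact ⟨⟨ψ, hψ⟩, by rw [← pureImage_symm h, hf]⟩)
    huniq
    (fun ψ ψ' χ h1 h2 => Subtype.ext
      (eq_of_pureImage_eq_one hK hconv h hunit χ.2 ψ'.2 ψ.2 h2 h1))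
  exact ⟨α, fun ψ χ => ⟨fun h1 => huniq ψ _ _ h1 (hα ψ), fun h1 => h1 ▸ hα ψ⟩⟩

end Main
end CompactConvex

theorem mainTheorem9 {E : Type*} [AddCommGroup E] [Module ℝ E] [TopologicalSpace E]
    [IsTopologicalAddGroup E] [ContinuousSMul ℝ E] [LocallyConvexSpace ℝ E] [T2Space E]
    (K : Set E) (hK : IsCompact K) (hconv : Convex ℝ K)
    (Φ : CompactConvex.Ac K ≃ CompactConvex.Ac K)
    (hunit : Φ (CompactConvex.unit K) = CompactConvex.unit K) :
    (CompactConvex.IsGaugeReversing Φ →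
      ∃ α : CompactConvex.extBd K ≃ CompactConvex.extBd K,
        CompactConvex.IsInducedByReversing Φ α ∧
        (∀ α' : CompactConvex.extBd K ≃ CompactConvex.extBd K,
          CompactConvex.IsInducedByReversing Φ α' → α' = α) ∧
        (∀ α' : CompactConvex.extBd K ≃ CompactConvex.extBd K,
          CompactConvex.ReciprocalOnBoundary Φ α' → α' = α) ∧
        (Function.Involutive Φ ↔ Function.Involutive α)) ∧
    (CompactConvex.IsGaugePreserving Φ →
      ∃ α : CompactConvex.extBd K ≃ CompactConvex.extBd K,
        CompactConvex.IsInducedByPreserving Φ α ∧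
        (∀ α' : CompactConvex.extBd K ≃ CompactConvex.extBd K,
          CompactConvex.IsInducedByPreserving Φ α' → α' = α) ∧
        (Function.Involutive Φ ↔ Function.Involutive α)) := by
  open CompactConvex in
  constructor
  · intro hrev
    have h := hrev.scaleAntitone hK
    obtain ⟨α, hα⟩ := h.exists_equiv hK hconv hunit
    obtain ⟨β, hβ⟩ := h.comp_self.exists_equiv hK hconv (by simp [hunit])
    -- Invariance under `Φ ∘ Φ` gives `pureImage Φ (α ψ) (β ψ) ≥ pureImage Φ ψ (α ψ) = 1`, which
    -- characterizes `β ψ` as `α (α ψ)`.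
    have hβα : ∀ ψ, β ψ = α (α ψ) := fun ψ => (hα _ _).1 <|
      le_antisymm (pureImage_le_one hunit _ _) <|
        ((hα ψ (α ψ)).2 rfl).ge.trans (pureImage_comp_self h fun f => hβ f ψ)
    refine ⟨α, fun ψ => ⟨isNormalizedExtremal_pureImage hK hconv h hunit ψ.2, (hα _ _).2 rfl⟩,
      fun α' hα' => Equiv.ext fun ψ => (hα _ _).1 (hα' ψ).2,
      fun α' hα' => Equiv.ext fun ψ => (hα _ _).1 (hα'.pureImage_eq_one hunit ψ), ?_⟩
    have h1 := involutive_iff_of_forall_apply_eq hK hconv hβ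
    simp only [hβα] at h1
    exact h1
  · intro hpres
    have h := hpres.scaleMonotone hK
    obtain ⟨α, hα⟩ := h.exists_equiv hK hconv hunit
    have hsymm : ∀ (f : Ac K) (ψ : extBd K), (Φ f).1 ψ = f.1 (α.symm ψ) := fun f ψ => by
      rw [← hα f (α.symm ψ), Equiv.apply_symm_apply]
    refine ⟨α, ⟨hsymm, fun g ψ => by rw [← hα, Equiv.apply_symm_apply]⟩, fun α' hα' => ?_, ?_⟩
    · refine Equiv.ext fun ψ => Subtype.ext
        (eq_of_forall_apply_eq hK hconv (α ψ).2 fun g => ?_)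
      obtain ⟨f, rfl⟩ := Φ.surjective g
      rw [hα, ← hα'.2, Equiv.symm_apply_apply]
    · exact involutive_iff_of_forall_apply_eq hK hconv (F := fun f => Φ (Φ f))
        (β := α.trans α) fun f ψ => by simp only [Equiv.trans_apply, hα]
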